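/- **Setting.** Let $x_{t+1}=\theta_*\phi(x_t,u_t)+w_t$, $x_0=0$, with $x_t,w_t\in\mathbb R^{n_x}$, $u_t\in\mathbb R^{n_u}$, $\theta_*\in\mathbb R^{n_x\times n_\phi}$, where the components of $\phi:\mathbb R^{n_x+n_u}\to\mathbb R^{n_\phi}$ are real analytic and linearly independent functions. Assume: (i) $(w_t)_{t\ge0}$ is i.i.d., has zero mean, covariance $\succeq\sigma_w^2 I\succ0$, satisfies $\|w_t\|_\infty\le w_{\max}$ almost surely, and its distribution is semi-continuous (no Lebesgue-null set has probability one); $(u_t)_{t\ge0}$ satisfies the same conditions with $\sigma_u$, $u_{\max}$; and the two sequences are independent. (ii) The system is locally input-to-state stable: $f(x,(w,u))=\theta_*\phi(x,u)+w$ vanishes at the origin, and there are $\rho_x>0$, $\rho>0$ with $\rho\ge\max(w_{\max},u_{\max})$, $\gamma\in\mathcal K$ and $\beta\in\mathcal{KL}$ such that, for every deterministic initial state with $\|x_0\|_2\le\rho_x$ and every deterministic input sequence $d_t=(w_t,u_t)$ with $\sup_t\|d_t\|_\infty\le\rho$, $\|x_t\|_2\le\beta(\|x_0\|_2,t)+\gamma(\sup_\tau\|d_\tau\|_\infty)$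 for all $t\ge0$. (iii) For some $c_w>0$ the bound $w_{\max}$ is tight with the linear tightness function $q_w(\ell)=c_w\ell$ (capped at $1$): for all $\ell>0$, $t\ge0$ and $1\le j\le n_x$, $\mathbb P(w_t^j+w_{\max}\le\ell)\ge\min\{c_w\ell,1\}$ and $\mathbb P(w_{\max}-w_t^j\le\ell)\ge\min\{c_w\ell,1\}$. (For example, uniform or truncated Gaussian disturbances on a box.) Let $\mathcal F_t=\sigma(w_0,\dots,w_{t-1},x_0,\dots,x_t,u_0,\dots,u_t)$, let $b_\phi=\sup_{t\ge0}\|\phi(x_t,u_t)\|_2$ (essential supremum), and let $$\Theta_T=\bigcap_{t=0}^{T-1}\{\hat\theta\in\mathbb R^{n_x\times n_\phi}:\ \|x_{t+1}-\hat\theta\phi(x_t,u_t)\|_\infty\le w_{\max}\},\qquad \operatorname{diam}(\Theta_T)=\sup_{\theta,\theta'\in\Theta_T}\|\theta-\theta'\|_F .$$ Say that $(s,p)$, $s>0$, $p\in(0,1)$, is a small-ball pair if $(\phi(x_t,u_t))_{t\ge1}$ satisfies the $(1,s^2I_{n_\phi},p)$-block martingale small-ball condition, that is, for every $v$ with $\|v\|_2=1$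 and every $t\ge1$, $\mathbb P(|v^\top\phi(x_{t+1},u_{t+1})|\ge s\mid\mathcal F_t)\ge p$ almost surely. **Claim.** There are absolute constants $K,C>0$ such that in every such setting $b_\phi<\infty$, a small-ball pair exists, and, for every small-ball pair $(s_\phi,p_\phi)$, every $\epsilon>0$ and all integers $T\ge m\ge0$ with $$m\ \ge\ K\,\frac{\log(T/\epsilon)+n_\phi\log\frac{8b_\phi}{s_\phi p_\phi}}{p_\phi^2},$$ with probability at least $1-2\epsilon$ $$\operatorname{diam}(\Theta_T)\ \le\ C\,\frac{\sqrt{n_x}\,\log\frac1\epsilon+n_x^{1.5}\,n_\phi\log\frac{b_\phi n_x}{s_\phi p_\phi}}{c_w\,s_\phi\,p_\phi\,T}.$$ For fixed $\epsilon$ this is an $O(1/T)$ rate. -/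

import Mathlib

open MeasureTheory ProbabilityTheory Filter Topology
open scoped ENNReal Matrix

/-- The Euclidean norm of a real vector. (The norm `‖·‖` of `ι → ℝ`, and of a product of two such
spaces, is the supremum norm `‖·‖_∞`.) -/
noncomputable def l2norm {ι : Type*} [Fintype ι] (v : ι → ℝ) : ℝ :=
  √(∑ i, v i ^ 2)

/-- The Frobenius norm of a real matrix. -/
noncomputable def frobNorm {m n : ℕ} (A : Matrix (Fin m) (Fin n) ℝ) : ℝ :=
  √(∑ i, ∑ j, A i j ^ 2)

/-- The diameter of a set of matrices in the Frobenius norm, with value `∞` on unbounded sets. -/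
noncomputable def frobDiam {m n : ℕ} (S : Set (Matrix (Fin m) (Fin n) ℝ)) : ℝ≥0∞ :=
  ⨆ θ ∈ S, ⨆ θ' ∈ S, ENNReal.ofReal (frobNorm (θ - θ'))

/-! ### Input-to-state stability -/

/-- `γ : [0, ∞) → [0, ∞)` is of class `𝒦`. -/
structure IsClassK (γ : ℝ → ℝ) : Prop where
  continuousOn : ContinuousOn γ (Set.Ici 0)
  strictMonoOn : StrictMonoOn γ (Set.Ici 0)
  map_zero : γ 0 = 0

/-- `β : [0, ∞) × [0, ∞) → [0, ∞)` is of class `𝒦ℒ`. -/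
structure IsClassKL (β : ℝ → ℝ → ℝ) : Prop where
  isClassK : ∀ t, 0 ≤ t → IsClassK fun r => β r t
  antitoneOn : ∀ r, 0 ≤ r → AntitoneOn (β r) (Set.Ici 0)
  tendsto_zero : ∀ r, 0 ≤ r → Tendsto (β r) atTop (𝓝 0)

/-- The system `x_{t+1} = f (x_t, d_t)` is locally input-to-state stable with radius `ρx` for the
initial state (Euclidean norm) and radius `ρ` for the inputs (the norm of `D`, which is the
supremum norm in the use below). -/
structure IsLISS {n : ℕ} {D : Type*} [NormedAddCommGroup D]
    (f : (Fin n → ℝ) → D → (Fin n → ℝ)) (ρx ρ : ℝ) : Prop where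
  continuous : Continuous fun z : (Fin n → ℝ) × D => f z.1 z.2
  map_zero : f 0 0 = 0
  radius_state_pos : 0 < ρx
  radius_input_pos : 0 < ρ
  bound : ∃ (γ : ℝ → ℝ) (β : ℝ → ℝ → ℝ), IsClassK γ ∧ IsClassKL β ∧
    ∀ (x : ℕ → Fin n → ℝ) (d : ℕ → D),
      l2norm (x 0) ≤ ρx → (∀ t, ‖d t‖ ≤ ρ) → (∀ t, x (t + 1) = f (x t) (d t)) →
        ∀ t : ℕ, l2norm (x t) ≤ β (l2norm (x 0)) t + γ (⨆ i, ‖d i‖)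

/-! ### The random inputs and disturbances -/

/-- A distribution is semi-continuous if no Lebesgue-null set has full probability. -/
def IsSemicontinuousLaw {n : ℕ} (ν : Measure (Fin n → ℝ)) : Prop :=
  ¬ ∃ E : Set (Fin n → ℝ), MeasurableSet E ∧ volume E = 0 ∧ ν E = 1

/-- The covariance matrix of a random vector. -/
noncomputable def covMatrix {Ω : Type*} [MeasurableSpace Ω] {n : ℕ} (μ : Measure Ω)
    (X : Ω → Fin n → ℝ) : Matrix (Fin n) (Fin n) ℝ :=
  Matrix.of fun i j => covariance (fun ω => X ω i) (fun ω => X ω j) μ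

/-- `X₀, X₁, …` are i.i.d. random vectors with a semi-continuous distribution, zero mean, positive
definite covariance matrix, and supremum norm almost surely at most `B`. -/
structure IsBoundedIIDSemicontinuous {Ω : Type*} [MeasurableSpace Ω] {n : ℕ} (μ : Measure Ω)
    (X : ℕ → Ω → Fin n → ℝ) (B : ℝ) : Prop where
  measurable : ∀ t, Measurable (X t)
  indep : iIndepFun X μ
  identDistrib : ∀ t, IdentDistrib (X t) (X 0) μ μ
  semicontinuous : ∀ t, IsSemicontinuousLaw (μ.map (X t))
  mean_zero : ∀ t i, ∫ ω, X t ω i ∂μ = 0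
  cov : ∃ σ : ℝ, 0 < σ ∧
    ∀ t, (covMatrix μ (X t) - σ ^ 2 • (1 : Matrix (Fin n) (Fin n) ℝ)).PosSemidef
  bounded : ∀ t, ∀ᵐ ω ∂μ, ‖X t ω‖ ≤ B

/-- The bound `wmax` on the disturbances is tight, with tightness function `q`: each coordinate
comes `ℓ`-close to `-wmax` and to `wmax` with probability at least `q ℓ > 0`. -/
def IsTightBound {Ω : Type*} [MeasurableSpace Ω] {n : ℕ} (μ : Measure Ω)
    (w : ℕ → Ω → Fin n → ℝ) (wmax : ℝ) (q : ℝ → ℝ) : Prop :=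
  ∀ ℓ : ℝ, 0 < ℓ → 0 < q ℓ ∧ ∀ (j : Fin n) (t : ℕ),
    q ℓ ≤ μ.real {ω | w t ω j + wmax ≤ ℓ} ∧ q ℓ ≤ μ.real {ω | wmax - w t ω j ≤ ℓ}

/-! ### The system, its data, and set-membership estimation -/

section System

variable {nx nu nφ : ℕ}

/-- All components of the feature map are real analytic on the whole space, and they are linearly
independent functions. -/
structure IsAnalyticFeatureMap (φ : (Fin nx → ℝ) × (Fin nu → ℝ) → Fin nφ → ℝ) : Prop where
  analytic : ∀ i, AnalyticOnNhd ℝ (fun z => φ z i) Set.univ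
  linearIndependent :
    LinearIndependent ℝ (fun (i : Fin nφ) (z : (Fin nx → ℝ) × (Fin nu → ℝ)) => φ z i)

/-- The right-hand side `θ φ(x, u) + w` of the dynamics, with exogenous input `d = (w, u)`. -/
def sysMap (θ : Matrix (Fin nx) (Fin nφ) ℝ) (φ : (Fin nx → ℝ) × (Fin nu → ℝ) → Fin nφ → ℝ)
    (x : Fin nx → ℝ) (d : (Fin nx → ℝ) × (Fin nu → ℝ)) : Fin nx → ℝ :=
  θ *ᵥ φ (x, d.2) + d.1

/-- The state process `x_{t+1} = θ φ(x_t, u_t) + w_t`, `x_0 = 0`. -/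
def sysState {Ω : Type*} (θ : Matrix (Fin nx) (Fin nφ) ℝ)
    (φ : (Fin nx → ℝ) × (Fin nu → ℝ) → Fin nφ → ℝ)
    (w : ℕ → Ω → Fin nx → ℝ) (u : ℕ → Ω → Fin nu → ℝ) : ℕ → Ω → Fin nx → ℝ
  | 0, _ => 0
  | t + 1, ω => sysMap θ φ (sysState θ φ w u t ω) (w t ω, u t ω)

/-- The process of feature vectors `φ(x_t, u_t)`. -/
def sysFeature {Ω : Type*} (θ : Matrix (Fin nx) (Fin nφ) ℝ)
    (φ : (Fin nx → ℝ) × (Fin nu → ℝ) → Fin nφ → ℝ)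
    (w : ℕ → Ω → Fin nx → ℝ) (u : ℕ → Ω → Fin nu → ℝ) (t : ℕ) (ω : Ω) : Fin nφ → ℝ :=
  φ (sysState θ φ w u t ω, u t ω)

/-- The (essential) supremum of `‖φ(x_t, u_t)‖₂` over all times. -/
noncomputable def featureSup {Ω : Type*} [MeasurableSpace Ω] (μ : Measure Ω)
    (θ : Matrix (Fin nx) (Fin nφ) ℝ) (φ : (Fin nx → ℝ) × (Fin nu → ℝ) → Fin nφ → ℝ)
    (w : ℕ → Ω → Fin nx → ℝ) (u : ℕ → Ω → Fin nu → ℝ) : ℝ≥0∞ :=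
  ⨆ t : ℕ, essSup (fun ω => ENNReal.ofReal (l2norm (sysFeature θ φ w u t ω))) μ

/-- The set-membership estimate `Θ_T` from the data `x_0, …, x_T, u_0, …, u_{T-1}`: all parameters
for which every residual up to time `T - 1` lies in `W`. -/
def smeSet (W : Set (Fin nx → ℝ)) (φ : (Fin nx → ℝ) × (Fin nu → ℝ) → Fin nφ → ℝ)
    (x : ℕ → Fin nx → ℝ) (u : ℕ → Fin nu → ℝ) (T : ℕ) : Set (Matrix (Fin nx) (Fin nφ) ℝ) :=
  ⋂ t ∈ Finset.range T, {θ | x (t + 1) - θ *ᵥ φ (x t, u t) ∈ W}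

theorem IsAnalyticFeatureMap.measurable {φ : (Fin nx → ℝ) × (Fin nu → ℝ) → Fin nφ → ℝ}
    (hφ : IsAnalyticFeatureMap φ) : Measurable φ :=
  measurable_pi_lambda _ fun i =>
    (continuousOn_univ.1 (hφ.analytic i).continuousOn).measurable

theorem measurable_sysState {Ω : Type*} [MeasurableSpace Ω] {θ : Matrix (Fin nx) (Fin nφ) ℝ}
    {φ : (Fin nx → ℝ) × (Fin nu → ℝ) → Fin nφ → ℝ} {w : ℕ → Ω → Fin nx → ℝ}
    {u : ℕ → Ω → Fin nu → ℝ} (hφ : Measurable φ) (hw : ∀ t, Measurable (w t))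
    (hu : ∀ t, Measurable (u t)) (t : ℕ) : Measurable (sysState θ φ w u t) := by
  induction t with
  | zero => exact measurable_const
  | succ t ih =>
    have h1 : Measurable fun ω => φ (sysState θ φ w u t ω, u t ω) :=
      hφ.comp (ih.prodMk (hu t))
    have h2 : Measurable fun v : Fin nφ → ℝ => θ *ᵥ v :=
      (Continuous.matrix_mulVec continuous_const continuous_id).measurable
    exact (h2.comp h1).add (hw t)

/-- The filtration `F_t = σ(w_0, …, w_{t-1}, x_0, …, x_t, u_0, …, u_t)`. -/
def sysFiltration {Ω : Type*} [mΩ : MeasurableSpace Ω] {w x : ℕ → Ω → Fin nx → ℝ}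
    {u : ℕ → Ω → Fin nu → ℝ} (hw : ∀ t, Measurable (w t)) (hx : ∀ t, Measurable (x t))
    (hu : ∀ t, Measurable (u t)) : Filtration ℕ mΩ where
  seq t := (⨆ i, ⨆ _ : i < t, MeasurableSpace.comap (w i) inferInstance) ⊔
    (⨆ i, ⨆ _ : i ≤ t, MeasurableSpace.comap (x i) inferInstance) ⊔
    (⨆ i, ⨆ _ : i ≤ t, MeasurableSpace.comap (u i) inferInstance)
  mono' s t hst := by
    refine sup_le_sup (sup_le_sup ?_ ?_) ?_
    · exact iSup_mono fun i => iSup_mono' fun hi => ⟨hi.trans_le hst, le_rfl⟩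
    · exact iSup_mono fun i => iSup_mono' fun hi => ⟨hi.trans hst, le_rfl⟩
    · exact iSup_mono fun i => iSup_mono' fun hi => ⟨hi.trans hst, le_rfl⟩
  le' t := by
    refine sup_le (sup_le ?_ ?_) ?_
    · exact iSup_le fun i => iSup_le fun _ => (hw i).comap_le
    · exact iSup_le fun i => iSup_le fun _ => (hx i).comap_le
    · exact iSup_le fun i => iSup_le fun _ => (hu i).comap_le

end System

/-- The `(k, Γ, p)`-block martingale small-ball condition for the process `y_1, y_2, …` and the
filtration `F_1 ⊆ F_2 ⊆ …`. -/
structure IsBMSB {Ω : Type*} [mΩ : MeasurableSpace Ω] {n : ℕ} (μ : Measure Ω)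
    (F : Filtration ℕ mΩ) (y : ℕ → Ω → Fin n → ℝ) (k : ℕ) (Γ : Matrix (Fin n) (Fin n) ℝ)
    (p : ℝ) : Prop where
  k_pos : 0 < k
  posDef : Γ.PosDef
  p_mem : p ∈ Set.Icc (0 : ℝ) 1
  adapted : ∀ t, 1 ≤ t → Measurable[F t] (y t)
  small_ball : ∀ v : Fin n → ℝ, l2norm v = 1 → ∀ t, 1 ≤ t → ∀ᵐ ω ∂μ,
    p ≤ (1 / (k : ℝ)) * ∑ i ∈ Finset.Icc 1 k,
      (μ[Set.indicator {ω' | √(v ⬝ᵥ Γ *ᵥ v) ≤ |v ⬝ᵥ y (t + i) ω'|} (fun _ => (1 : ℝ)) | F t]) ω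

/-! The estimate compares rows. If the diameter exceeds `2 √nx r`, some consistent `θ'` has a row
`x` of `θ' - θ`, say the `j`-th, with `‖x‖₂ ≥ r`, and consistency reads `|w_t^j - x·y_t| ≤ wmax`,
where `y_t = φ(x_t, u_t)`. Such a row is refuted at time `t` if `x·y_t > s r / 2` while `w_t^j` is
within `s r / 2` of `-wmax`, or symmetrically with the other sign. For a fixed unit vector `v`, the
small-ball condition gives `|v·y_t| ≥ s` with conditional probability at least `p`; since `w_t` is
independent of the past, whichever sign occurs is then matched by the noise with probability at
least `q = min (cw s r / 2) 1`. About `T / 2` such tests all fail with probability at most `(1 - p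
q) ^ k ≤ exp (-p q k)` (`measureReal_forall_notMem_le`).

A net of the unit sphere (`exists_finset_sphere_net`) reduces all directions to finitely many
(`exists_forall_not_of_row`), and a union bound over net points and rows finishes
(`measure_exists_row_le`). The choice `r ~ Λ / (cw s p T)`, with `Λ` the logarithmic term, makes `p
q k` a multiple of `Λ` as long as `q < 1`. If the window is so wide that `q = 1`, the noise
satisfies its half of every test almost surely. No union over rows is then needed, and the lower
bound on `m`, which does not involve `nx`, suffices (`measure_exists_row_le_of_eq_one`).

Existence of a small-ball pair is a compactness argument. Given the past, `x_{t+1} = a + w_t` with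
`a` known and bounded by stability, and `(w_t, u_{t+1})` is fresh. A nonzero combination `v·φ` is
analytic, so its zeros are Lebesgue-null and cannot carry a product of semi-continuous laws. Hence
the second moment of `v·φ(a + w, u)` is positive; it is continuous in `(a, v)` on a compact set, so
it is bounded below, and a Paley–Zygmund bound gives `s` and `p` (`exists_uniform_small_ball`). -/

/-! ### Zero sets of real analytic functions -/

/-- Nonzero real analytic functions have `μ`-null zero sets. -/
def HasNullAnalyticZeros {E : Type*} [NormedAddCommGroup E] [NormedSpace ℝ E] [MeasurableSpace E]
    (μ : Measure E) : Prop :=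
  ∀ f : E → ℝ, AnalyticOnNhd ℝ f Set.univ → (∃ x, f x ≠ 0) → μ {x | f x = 0} = 0

/-- By the identity theorem the zeros are isolated, and a discrete subset of the line is countable.
-/
theorem hasNullAnalyticZeros_real : HasNullAnalyticZeros (volume : Measure ℝ) := by
  rintro f hf ⟨x, hx⟩
  have h := hf.preimage_zero_mem_codiscrete hx
  have h2 : (f ⁻¹' {0}ᶜ)ᶜ.Countable := by
    refine (HereditarilyLindelofSpace.isLindelof _).countable_of_isDiscrete ?_
    simpa using isDiscrete_of_codiscreteWithin (U := Set.univ) (s := (f ⁻¹' {0}ᶜ)ᶜ) (by rw [compl_compl]; exact h)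
  have h3 : {x | f x = 0} = (f ⁻¹' {0}ᶜ)ᶜ := by ext; simp
  rw [h3]
  exact h2.measure_zero _

/-- Fubini: if `f (x₀, y₀) ≠ 0`, then `f (x, y₀) ≠ 0` for almost every `x`, and for each such `x`
the slice `f (x, ·)` is analytic and not identically zero, hence has null zeros. -/
theorem HasNullAnalyticZeros.prod {E F : Type*} [NormedAddCommGroup E] [NormedSpace ℝ E]
    [MeasurableSpace E] [BorelSpace E] [SecondCountableTopology E]
    [NormedAddCommGroup F] [NormedSpace ℝ F] [MeasurableSpace F] [BorelSpace F]
    [SecondCountableTopology F] {μ : Measure E} {ν : Measure F} [SFinite μ] [SFinite ν]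
    (hμ : HasNullAnalyticZeros μ) (hν : HasNullAnalyticZeros ν) :
    HasNullAnalyticZeros (μ.prod ν) := by
  rintro f hf ⟨⟨x₀, y₀⟩, h₀⟩
  have hc : Continuous f := continuousOn_univ.1 hf.continuousOn
  have hmeas : MeasurableSet {z | f z = 0} := hc.measurable (measurableSet_singleton 0)
  rw [Measure.measure_prod_null hmeas]
  have h1 : μ {x | f (x, y₀) = 0} = 0 := by
    apply hμ (fun x => f (x, y₀)) _ ⟨x₀, h₀⟩
    intro x _
    exact (hf (x, y₀) trivial).comp₂ analyticAt_id analyticAt_const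
  have h2 : ∀ᵐ x ∂μ, x ∉ {x | f (x, y₀) = 0} := measure_eq_zero_iff_ae_notMem.1 h1
  filter_upwards [h2] with x hx
  apply hν (fun y => f (x, y)) _ ⟨y₀, hx⟩
  intro y _
  exact (hf (x, y) trivial).comp₂ analyticAt_const analyticAt_id

theorem HasNullAnalyticZeros.map {E F : Type*} [NormedAddCommGroup E] [NormedSpace ℝ E]
    [MeasurableSpace E]
    [NormedAddCommGroup F] [NormedSpace ℝ F] [MeasurableSpace F]
    {μ : Measure E} {ν : Measure F} (hμ : HasNullAnalyticZeros μ) (e : E ≃L[ℝ] F)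
    (hmp : MeasurePreserving e.symm ν μ) (he : MeasurableEmbedding e.symm) :
    HasNullAnalyticZeros ν := by
  rintro f hf ⟨y, hy⟩
  have h := hμ (fun x => f (e x))
    (fun x _ => (hf (e x) trivial).comp (e.toContinuousLinearMap.analyticAt x))
    ⟨e.symm y, by simpa using hy⟩
  rw [← hmp.measure_preimage_emb he] at h
  simpa using h

theorem hasNullAnalyticZeros_pi (n : ℕ) :
    HasNullAnalyticZeros (volume : Measure (Fin n → ℝ)) := by
  induction n with
  | zero =>
    rintro f - ⟨x, hx⟩
    have : {x | f x = 0} = ∅ := by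
      ext y
      simpa [Subsingleton.elim y x] using hx
    simp [this]
  | succ n ih =>
    have h := hasNullAnalyticZeros_real.prod ih
    refine h.map (Fin.consEquivL ℝ (fun _ : Fin (n + 1) => ℝ)) ?_ ?_
    · exact volume_preserving_piFinSuccAbove (fun _ : Fin (n + 1) => ℝ) 0
    · exact (MeasurableEquiv.piFinSuccAbove (fun _ : Fin (n + 1) => ℝ) 0).measurableEmbedding

/-! ### Independence of the noise from the past -/

theorem iIndep_sumElim {Ω ι κ : Type*} [MeasurableSpace Ω] {μ : Measure Ω}
    {m₁ : ι → MeasurableSpace Ω} {m₂ : κ → MeasurableSpace Ω}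
    (h₁ : iIndep m₁ μ) (h₂ : iIndep m₂ μ) (h : Indep (⨆ i, m₁ i) (⨆ j, m₂ j) μ) :
    iIndep (Sum.elim m₁ m₂) μ := by
  rw [iIndep_iff]
  intro s f hf
  have hl : ∀ i ∈ s.toLeft, MeasurableSet[m₁ i] (f (Sum.inl i)) := fun i hi =>
    hf (Sum.inl i) (Finset.mem_toLeft.1 hi)
  have hr : ∀ i ∈ s.toRight, MeasurableSet[m₂ i] (f (Sum.inr i)) := fun i hi =>
    hf (Sum.inr i) (Finset.mem_toRight.1 hi)
  have hsplit : ⋂ i ∈ s, f i =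
      (⋂ i ∈ s.toLeft, f (Sum.inl i)) ∩ ⋂ i ∈ s.toRight, f (Sum.inr i) := by
    ext x
    simp [Set.mem_iInter, Sum.forall]
  rw [hsplit, ← Finset.toLeft_disjSum_toRight (u := s), Finset.prod_disjSum,
    Finset.toLeft_disjSum, Finset.toRight_disjSum, ← h₁.meas_biInter hl, ← h₂.meas_biInter hr]
  refine (Indep_iff _ _ _).1 h _ _ ?_ ?_
  · refine @Finset.measurableSet_biInter _ _ (⨆ i, m₁ i) _ _ fun i hi => ?_
    exact le_iSup m₁ i _ (hl i hi)
  · refine @Finset.measurableSet_biInter _ _ (⨆ i, m₂ i) _ _ fun i hi => ?_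
    exact le_iSup m₂ i _ (hr i hi)

section Noise

variable {Ω : Type*} {nx nu nφ : ℕ}
  {θ : Matrix (Fin nx) (Fin nφ) ℝ} {φ : (Fin nx → ℝ) × (Fin nu → ℝ) → Fin nφ → ℝ}
  {w : ℕ → Ω → Fin nx → ℝ} {u : ℕ → Ω → Fin nu → ℝ}

/-- The `σ`-algebra generated by `w_0, …, w_{t-1}, u_0, …, u_t`. -/
abbrev noiseSigma (w : ℕ → Ω → Fin nx → ℝ) (u : ℕ → Ω → Fin nu → ℝ) (t : ℕ) : MeasurableSpace Ω :=
  (⨆ i, ⨆ _ : i < t, MeasurableSpace.comap (w i) inferInstance) ⊔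
    (⨆ i, ⨆ _ : i ≤ t, MeasurableSpace.comap (u i) inferInstance)

theorem measurable_noiseSigma_left {s t : ℕ} (h : s < t) : Measurable[noiseSigma w u t] (w s) :=
  measurable_iff_comap_le.2 <| le_sup_of_le_left <| le_iSup₂_of_le s h le_rfl

theorem measurable_noiseSigma_right {s t : ℕ} (h : s ≤ t) : Measurable[noiseSigma w u t] (u s) :=
  measurable_iff_comap_le.2 <| le_sup_of_le_right <| le_iSup₂_of_le s h le_rfl

theorem measurable_noiseSigma_sysState (hφ : Measurable φ) {s t : ℕ} (h : s ≤ t) :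
    Measurable[noiseSigma w u t] (sysState θ φ w u s) := by
  induction s with
  | zero => exact measurable_const
  | succ s ih =>
    have h1 : Measurable[noiseSigma w u t] fun ω => φ (sysState θ φ w u s ω, u s ω) :=
      hφ.comp ((ih (by lia)).prodMk (measurable_noiseSigma_right (by lia)))
    have h2 : Measurable fun v : Fin nφ → ℝ => θ *ᵥ v :=
      (Continuous.matrix_mulVec continuous_const continuous_id).measurable
    exact (h2.comp h1).add (measurable_noiseSigma_left (by lia))

variable [MeasurableSpace Ω] {μ : Measure Ω}

theorem iIndep_comap_sumElim (hw : iIndepFun w μ) (hu : iIndepFun u μ)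
    (hwu : IndepFun (fun ω t => w t ω) (fun ω t => u t ω) μ) :
    iIndep (Sum.elim (fun t => MeasurableSpace.comap (w t) inferInstance)
      (fun t => MeasurableSpace.comap (u t) inferInstance)) μ := by
  refine iIndep_sumElim hw.iIndep hu.iIndep ?_
  have h := (IndepFun_iff_Indep _ _ _).1 hwu
  simpa only [MeasurableSpace.pi, MeasurableSpace.comap_iSup, MeasurableSpace.comap_comp,
    Function.comp_def] using h

/-- The states are functions of the earlier noise and inputs, so they add no information.
Independence from the past thus reduces to disjointness of index sets in one independent family. -/
theorem sysFiltration_le_noiseSigma (hφ : Measurable φ) (hw : ∀ t, Measurable (w t))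
    (hx : ∀ t, Measurable (sysState θ φ w u t)) (hu : ∀ t, Measurable (u t)) (t : ℕ) :
    sysFiltration hw hx hu t ≤ noiseSigma w u t := by
  refine sup_le (sup_le le_sup_left ?_) le_sup_right
  exact iSup₂_le fun i hi => (measurable_noiseSigma_sysState hφ hi).comap_le

theorem indep_noiseSigma (hwm : ∀ t, Measurable (w t)) (hum : ∀ t, Measurable (u t))
    (hw : iIndepFun w μ) (hu : iIndepFun u μ)
    (hwu : IndepFun (fun ω t => w t ω) (fun ω t => u t ω) μ) (t : ℕ) :
    Indep (noiseSigma w u t) (MeasurableSpace.comap (w t) inferInstance ⊔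
      MeasurableSpace.comap (u (t + 1)) inferInstance) μ := by
  have h := indep_iSup_of_disjoint (S := {i | Sum.elim (· < t) (· ≤ t) i})
    (T := {i | Sum.elim (· = t) (· = t + 1) i}) ?_ (iIndep_comap_sumElim hw hu hwu) ?_
  · refine indep_of_indep_of_le_left (indep_of_indep_of_le_right h ?_) ?_
    · exact sup_le (le_iSup₂_of_le (Sum.inl t) (by simp) le_rfl)
        (le_iSup₂_of_le (Sum.inr (t + 1)) (by simp) le_rfl)
    · refine sup_le (iSup₂_le fun i hi => ?_) (iSup₂_le fun i hi => ?_)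
      · exact le_iSup₂_of_le (Sum.inl i) (by simpa) le_rfl
      · exact le_iSup₂_of_le (Sum.inr i) (by simpa) le_rfl
  · rintro (i | i)
    · exact (hwm i).comap_le
    · exact (hum i).comap_le
  · rw [Set.disjoint_left]
    rintro (i | i) <;> simp <;> lia

theorem indepFun_pair_noise (hwu : IndepFun (fun ω t => w t ω) (fun ω t => u t ω) μ) (s t : ℕ) :
    IndepFun (w s) (u t) μ :=
  hwu.comp (φ := fun x : ℕ → Fin nx → ℝ => x s) (ψ := fun x : ℕ → Fin nu → ℝ => x t)
    (measurable_pi_apply s) (measurable_pi_apply t)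

end Noise

/-! ### Semi-continuous laws -/

/-- If a null set `E` had full probability, almost every slice would have full `ν₂`-probability and
so, by semi-continuity of `ν₂`, positive volume. But by Fubini the points with a slice of positive
volume form a null set, which `ν₁` would then charge fully. -/
theorem IsSemicontinuousLaw.prod_ne_one {n m : ℕ} {ν₁ : Measure (Fin n → ℝ)}
    {ν₂ : Measure (Fin m → ℝ)} [IsProbabilityMeasure ν₁] [IsProbabilityMeasure ν₂]
    (h₁ : IsSemicontinuousLaw ν₁) (h₂ : IsSemicontinuousLaw ν₂)
    {E : Set ((Fin n → ℝ) × (Fin m → ℝ))} (hE : MeasurableSet E) (h0 : volume E = 0) :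
    ¬ ∀ᵐ z ∂(ν₁.prod ν₂), z ∈ E := by
  intro hall
  apply h₁
  have hmeas : Measurable fun x : Fin n → ℝ =>
    (volume : Measure (Fin m → ℝ)) (Prod.mk x ⁻¹' E) := measurable_measure_prodMk_left hE
  refine ⟨{x | volume (Prod.mk x ⁻¹' E) ≠ 0}, (hmeas (measurableSet_singleton 0)).compl, ?_, ?_⟩
  · exact (Measure.measure_prod_null hE).1 h0
  · refine (mem_ae_iff_prob_eq_one (hmeas (measurableSet_singleton 0)).compl).1 ?_
    filter_upwards [Measure.ae_ae_of_ae_prod hall] with x hx hx0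
    have hm : MeasurableSet (Prod.mk x ⁻¹' E) := measurable_prodMk_left hE
    exact h₂ ⟨_, hm, hx0, (mem_ae_iff_prob_eq_one hm).1 hx⟩

/-! ### The Euclidean norm -/

theorem l2norm_nonneg {ι : Type*} [Fintype ι] (v : ι → ℝ) : 0 ≤ l2norm v := Real.sqrt_nonneg _

theorem l2norm_sq {ι : Type*} [Fintype ι] (v : ι → ℝ) : l2norm v ^ 2 = ∑ i, v i ^ 2 :=
  Real.sq_sqrt (Finset.sum_nonneg fun _ _ => sq_nonneg _)

@[simp] theorem l2norm_zero {ι : Type*} [Fintype ι] : l2norm (0 : ι → ℝ) = 0 := by simp [l2norm]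

theorem continuous_l2norm {ι : Type*} [Fintype ι] : Continuous (l2norm : (ι → ℝ) → ℝ) := by
  unfold l2norm
  fun_prop

theorem abs_le_l2norm {ι : Type*} [Fintype ι] (v : ι → ℝ) (i : ι) : |v i| ≤ l2norm v :=
  Real.abs_le_sqrt (Finset.single_le_sum (f := fun i => v i ^ 2) (fun _ _ => sq_nonneg _)
    (Finset.mem_univ i))

theorem norm_le_l2norm {ι : Type*} [Fintype ι] (v : ι → ℝ) : ‖v‖ ≤ l2norm v :=
  (pi_norm_le_iff_of_nonneg (l2norm_nonneg v)).2 fun i => abs_le_l2norm v i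

theorem l2norm_smul {ι : Type*} [Fintype ι] (c : ℝ) (v : ι → ℝ) :
    l2norm (c • v) = |c| * l2norm v := by
  simp only [l2norm, Pi.smul_apply, smul_eq_mul, mul_pow, ← Finset.mul_sum]
  rw [Real.sqrt_mul (sq_nonneg c), Real.sqrt_sq_eq_abs]

theorem abs_dotProduct_le {ι : Type*} [Fintype ι] (v x : ι → ℝ) :
    |v ⬝ᵥ x| ≤ l2norm v * l2norm x := by
  rw [l2norm, l2norm, ← Real.sqrt_mul (Finset.sum_nonneg fun _ _ => sq_nonneg _)]
  exact Real.abs_le_sqrt (Finset.sum_mul_sq_le_sq_mul_sq _ _ _)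

theorem l2norm_le_sqrt_mul {ι : Type*} [Fintype ι] {v : ι → ℝ} {δ : ℝ} (hδ : 0 ≤ δ)
    (h : ∀ i, |v i| ≤ δ) : l2norm v ≤ √(Fintype.card ι) * δ := by
  rw [l2norm, ← Real.sqrt_sq hδ, ← Real.sqrt_mul (Nat.cast_nonneg _)]
  apply Real.sqrt_le_sqrt
  calc ∑ i, v i ^ 2 ≤ ∑ _i : ι, δ ^ 2 := Finset.sum_le_sum fun i _ => by
        rw [← sq_abs]; exact pow_le_pow_left₀ (abs_nonneg _) (h i) 2
    _ = _ := by simp [Finset.sum_const]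

theorem isCompact_l2norm_eq_one (n : ℕ) : IsCompact {v : Fin n → ℝ | l2norm v = 1} := by
  refine Metric.isCompact_of_isClosed_isBounded
    (isClosed_eq continuous_l2norm continuous_const) ?_
  refine (Metric.isBounded_closedBall (x := 0) (r := 1)).subset fun v hv => ?_
  rw [mem_closedBall_zero_iff]
  exact (norm_le_l2norm v).trans (le_of_eq hv)

/-! ### Boundedness of the state and of the features -/

section Bounded

variable {Ω : Type*} {nx nu nφ : ℕ}
  {θ : Matrix (Fin nx) (Fin nφ) ℝ} {φ : (Fin nx → ℝ) × (Fin nu → ℝ) → Fin nφ → ℝ}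
  {w : ℕ → Ω → Fin nx → ℝ} {u : ℕ → Ω → Fin nu → ℝ}

theorem IsAnalyticFeatureMap.continuous (hφ : IsAnalyticFeatureMap φ) : Continuous φ :=
  continuous_pi fun i => continuousOn_univ.1 (hφ.analytic i).continuousOn

theorem IsLISS.exists_norm_sysState_le {ρx ρ : ℝ} (h : IsLISS (sysMap θ φ) ρx ρ) :
    ∃ R : ℝ, ∀ ω : Ω, (∀ t, ‖w t ω‖ ≤ ρ) → (∀ t, ‖u t ω‖ ≤ ρ) →
      ∀ t, ‖sysState θ φ w u t ω‖ ≤ R := by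
  obtain ⟨γ, β, hγ, hβ, hb⟩ := h.bound
  refine ⟨γ ρ, fun ω hw hu t => (norm_le_l2norm _).trans ?_⟩
  have hd : ∀ t, ‖(w t ω, u t ω)‖ ≤ ρ := fun t => max_le (hw t) (hu t)
  have h1 := hb (fun t => sysState θ φ w u t ω) (fun t => (w t ω, u t ω))
    (by simpa [sysState] using h.radius_state_pos.le) hd (fun t => rfl) t
  -- Starting at the origin removes the `𝒦ℒ` term, so `γ ρ` bounds every state.
  have h0 : l2norm (sysState θ φ w u 0 ω) = 0 := by simp [sysState]
  rw [h0, (hβ.isClassK t (Nat.cast_nonneg t)).map_zero, zero_add] at h1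
  refine h1.trans (hγ.strictMonoOn.monotoneOn ?_ h.radius_input_pos.le (ciSup_le hd))
  exact Real.iSup_nonneg fun t => norm_nonneg _

theorem exists_l2norm_feature_le (hφ : Continuous φ) (R ρ : ℝ) :
    ∃ B : ℝ, 0 < B ∧ ∀ x u, ‖x‖ ≤ R → ‖u‖ ≤ ρ → l2norm (φ (x, u)) ≤ B := by
  have hK : IsCompact (Metric.closedBall (0 : Fin nx → ℝ) R ×ˢ
      Metric.closedBall (0 : Fin nu → ℝ) ρ) :=
    (isCompact_closedBall _ _).prod (isCompact_closedBall _ _)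
  obtain ⟨B, hB⟩ := hK.exists_bound_of_continuousOn (continuous_l2norm.comp hφ).continuousOn
  refine ⟨max B 1, by positivity, fun x u hx hu => le_max_of_le_left ?_⟩
  exact (le_abs_self _).trans (hB (x, u) ⟨by simpa using hx, by simpa using hu⟩)

variable [MeasurableSpace Ω] {μ : Measure Ω}

theorem featureSup_ne_top {R ρ : ℝ} (hφ : Continuous φ)
    (hx : ∀ᵐ ω ∂μ, ∀ t, ‖sysState θ φ w u t ω‖ ≤ R) (hu : ∀ᵐ ω ∂μ, ∀ t, ‖u t ω‖ ≤ ρ) :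
    featureSup μ θ φ w u ≠ ∞ := by
  obtain ⟨B, -, hB⟩ := exists_l2norm_feature_le hφ R ρ
  refine ne_top_of_le_ne_top (ENNReal.ofReal_ne_top (r := B)) (iSup_le fun t => ?_)
  refine essSup_le_of_ae_le _ ?_
  filter_upwards [hx, hu] with ω hx hu
  exact ENNReal.ofReal_le_ofReal (hB _ _ (hx t) (hu t))

theorem ae_l2norm_sysFeature_le (h : featureSup μ θ φ w u ≠ ∞) :
    ∀ᵐ ω ∂μ, ∀ t, l2norm (sysFeature θ φ w u t ω) ≤ (featureSup μ θ φ w u).toReal := by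
  rw [ae_all_iff]
  intro t
  filter_upwards [ENNReal.ae_le_essSup
    (fun ω => ENNReal.ofReal (l2norm (sysFeature θ φ w u t ω)))] with ω hω
  exact (ENNReal.ofReal_le_iff_le_toReal h).1 (hω.trans (le_iSup (fun t : ℕ => essSup
    (fun ω => ENNReal.ofReal (l2norm (sysFeature θ φ w u t ω))) μ) t))

end Bounded

/-! ### Existence of a small-ball pair -/

section SmallBall

variable {nx nu nφ : ℕ} {φ : (Fin nx → ℝ) × (Fin nu → ℝ) → Fin nφ → ℝ}

theorem IsAnalyticFeatureMap.volume_zeros (hφ : IsAnalyticFeatureMap φ) (a : Fin nx → ℝ)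
    {v : Fin nφ → ℝ} (hv : v ≠ 0) :
    volume {z : (Fin nx → ℝ) × (Fin nu → ℝ) | v ⬝ᵥ φ (a + z.1, z.2) = 0} = 0 := by
  refine (hasNullAnalyticZeros_pi nx).prod (hasNullAnalyticZeros_pi nu)
    (fun z => v ⬝ᵥ φ (a + z.1, z.2)) ?_ ?_
  · intro z _
    have h1 : AnalyticAt ℝ (fun z : (Fin nx → ℝ) × (Fin nu → ℝ) => (a + z.1, z.2)) z :=
      (analyticAt_const.add analyticAt_fst).prod analyticAt_snd
    simp only [dotProduct]
    refine Finset.analyticAt_fun_sum _ fun i _ => analyticAt_const.mul ?_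
    exact AnalyticAt.fun_comp (g := fun y => φ y i) (hφ.analytic i (a + z.1, z.2) trivial) h1
  · by_contra! h
    apply hv
    have := Fintype.linearIndependent_iff.1 hφ.linearIndependent v ?_
    · exact funext this
    · ext z
      simpa [dotProduct] using h (z.1 - a, z.2)

variable {ν₁ : Measure (Fin nx → ℝ)} {ν₂ : Measure (Fin nu → ℝ)} [IsProbabilityMeasure ν₁]
  [IsProbabilityMeasure ν₂]

theorem IsAnalyticFeatureMap.integral_sq_pos (hφ : IsAnalyticFeatureMap φ)
    (h₁ : IsSemicontinuousLaw ν₁) (h₂ : IsSemicontinuousLaw ν₂) (a : Fin nx → ℝ)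
    {v : Fin nφ → ℝ} (hv : v ≠ 0)
    (hint : Integrable (fun z => (v ⬝ᵥ φ (a + z.1, z.2)) ^ 2) (ν₁.prod ν₂)) :
    0 < ∫ z, (v ⬝ᵥ φ (a + z.1, z.2)) ^ 2 ∂(ν₁.prod ν₂) := by
  refine lt_of_le_of_ne (integral_nonneg fun z => sq_nonneg _) fun h => ?_
  have h0 := (integral_eq_zero_iff_of_nonneg (fun z => sq_nonneg _) hint).1 h.symm
  have hc : Continuous fun z : (Fin nx → ℝ) × (Fin nu → ℝ) => v ⬝ᵥ φ (a + z.1, z.2) :=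
    continuous_const.dotProduct (hφ.continuous.comp (by fun_prop))
  refine h₁.prod_ne_one h₂ (hc.measurable (measurableSet_singleton 0)) (hφ.volume_zeros a hv) ?_
  filter_upwards [h0] with z hz
  simpa using hz

/-- Uniformity in `a` and `v` is what lets a single pair serve for all times, pasts and directions.
-/
theorem IsAnalyticFeatureMap.exists_uniform_small_ball (hφ : IsAnalyticFeatureMap φ)
    (h₁ : IsSemicontinuousLaw ν₁) (h₂ : IsSemicontinuousLaw ν₂) {r₁ r₂ : ℝ}
    (hr₁ : ∀ᵐ x ∂ν₁, ‖x‖ ≤ r₁) (hr₂ : ∀ᵐ x ∂ν₂, ‖x‖ ≤ r₂) (R : ℝ) :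
    ∃ s p : ℝ, 0 < s ∧ 0 < p ∧ p < 1 ∧ ∀ (a : Fin nx → ℝ) (v : Fin nφ → ℝ), ‖a‖ ≤ R →
      l2norm v = 1 → p ≤ (ν₁.prod ν₂).real {z | s ≤ |v ⬝ᵥ φ (a + z.1, z.2)|} := by
  obtain ⟨B, hB0, hB⟩ := exists_l2norm_feature_le hφ.continuous (R + r₁) r₂
  set K : Set ((Fin nx → ℝ) × (Fin nφ → ℝ)) :=
    Metric.closedBall 0 R ×ˢ {v | l2norm v = 1} with hK
  have hKc : IsCompact K := (isCompact_closedBall _ _).prod (isCompact_l2norm_eq_one nφ)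
  set Y : (Fin nx → ℝ) × (Fin nφ → ℝ) → (Fin nx → ℝ) × (Fin nu → ℝ) → ℝ :=
    fun k z => k.2 ⬝ᵥ φ (k.1 + z.1, z.2) with hY
  have hYc : ∀ k, Continuous (Y k) := fun k =>
    continuous_const.dotProduct (hφ.continuous.comp (by fun_prop))
  have hYc' : ∀ z, Continuous fun k => Y k z := fun z =>
    continuous_snd.dotProduct (hφ.continuous.comp (by fun_prop))
  have hfst : ∀ᵐ z ∂(ν₁.prod ν₂), ‖z.1‖ ≤ r₁ := Measure.quasiMeasurePreserving_fst.ae hr₁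
  have hsnd : ∀ᵐ z ∂(ν₁.prod ν₂), ‖z.2‖ ≤ r₂ := Measure.quasiMeasurePreserving_snd.ae hr₂
  have hYB : ∀ k ∈ K, ∀ᵐ z ∂(ν₁.prod ν₂), |Y k z| ≤ B := by
    rintro ⟨a, v⟩ ⟨ha, hv⟩
    filter_upwards [hfst, hsnd] with z hz1 hz2
    have ha' : ‖a‖ ≤ R := by simpa using ha
    have hv' : l2norm v = 1 := hv
    refine (abs_dotProduct_le _ _).trans ?_
    rw [hv', one_mul]
    exact hB _ _ ((norm_add_le _ _).trans (add_le_add ha' hz1)) hz2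
  have hYB2 : ∀ k ∈ K, ∀ᵐ z ∂(ν₁.prod ν₂), ‖Y k z ^ 2‖ ≤ B ^ 2 := by
    intro k hk
    filter_upwards [hYB k hk] with z hz
    rw [norm_pow, Real.norm_eq_abs]
    exact pow_le_pow_left₀ (abs_nonneg _) hz 2
  have hint : ∀ k ∈ K, Integrable (fun z => Y k z ^ 2) (ν₁.prod ν₂) := fun k hk =>
    Integrable.of_bound ((hYc k).pow 2).aestronglyMeasurable (B ^ 2) (hYB2 k hk)
  have hcont : ContinuousOn (fun k => ∫ z, Y k z ^ 2 ∂(ν₁.prod ν₂)) K :=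
    continuousOn_of_dominated (fun k _ => ((hYc k).pow 2).aestronglyMeasurable) hYB2
      (integrable_const _) (Eventually.of_forall fun z => ((hYc' z).pow 2).continuousOn)
  -- `K` is empty if `nφ = 0` (no unit vectors) or `R < 0`; any pair then works.
  rcases K.eq_empty_or_nonempty with hKe | hKne
  · refine ⟨1, 1 / 2, by norm_num, by norm_num, by norm_num, fun a v ha hv => ?_⟩
    have : (a, v) ∈ K := ⟨by simpa using ha, hv⟩
    simp [hKe] at this
  obtain ⟨k₀, hk₀, hmin⟩ := hKc.exists_isMinOn hKne hcont
  set h₀ := ∫ z, Y k₀ z ^ 2 ∂(ν₁.prod ν₂) with hh₀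
  have hh₀pos : 0 < h₀ := by
    refine hφ.integral_sq_pos h₁ h₂ k₀.1 (v := k₀.2) ?_ (hint k₀ hk₀)
    intro hz
    have h1 : l2norm k₀.2 = 1 := hk₀.2
    rw [hz, l2norm_zero] at h1
    exact zero_ne_one h1
  -- The square of `Y` is at most `h₀ / 2` below the threshold `√(h₀ / 2)` and at most `B ^ 2` above
  -- it, so its mean, at least `h₀`, forces the upper event to have probability at least `h₀ / (2 B
  -- ^ 2)`. The minimum with `1 / 2` only ensures `p < 1`.
  refine ⟨√(h₀ / 2), min (h₀ / (2 * B ^ 2)) (1 / 2), by positivity, by positivity,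
    (min_le_right _ _).trans_lt (by norm_num), fun a v ha hv => (min_le_left _ _).trans ?_⟩
  have hk : (a, v) ∈ K := ⟨by simpa using ha, hv⟩
  set A : Set ((Fin nx → ℝ) × (Fin nu → ℝ)) := {z | √(h₀ / 2) ≤ |Y (a, v) z|} with hA
  have hAm : MeasurableSet A := measurableSet_le measurable_const (hYc (a, v)).measurable.abs
  have hle : h₀ ≤ h₀ / 2 + B ^ 2 * (ν₁.prod ν₂).real A := by
    calc h₀ ≤ ∫ z, Y (a, v) z ^ 2 ∂(ν₁.prod ν₂) := hmin hk
      _ ≤ ∫ z, (h₀ / 2 + A.indicator (fun _ => B ^ 2) z) ∂(ν₁.prod ν₂) := by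
        refine integral_mono_ae (hint _ hk)
          ((integrable_const _).add ((integrable_const _).indicator hAm)) ?_
        filter_upwards [hYB _ hk] with z hz
        rw [← sq_abs]
        by_cases hzA : z ∈ A
        · rw [Set.indicator_of_mem hzA]
          have := pow_le_pow_left₀ (abs_nonneg _) hz 2
          linarith
        · rw [Set.indicator_of_notMem hzA, add_zero]
          have h1 : |Y (a, v) z| < √(h₀ / 2) := not_le.1 hzA
          have h2 := pow_le_pow_left₀ (abs_nonneg _) h1.le 2
          rwa [Real.sq_sqrt (by positivity)] at h2
      _ = h₀ / 2 + B ^ 2 * (ν₁.prod ν₂).real A := by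
        rw [integral_add (integrable_const _) ((integrable_const _).indicator hAm),
          integral_indicator_const _ hAm]
        simp [mul_comm]
  rw [div_le_iff₀ (by positivity)]
  linarith

end SmallBall

/-- Freezing: given `m`, the value of `a` is known while `Z` keeps its law, so the conditional
probability is that of the slice of `S` at `a`. The bound is checked by integrating over the sets of
`m`. -/
theorem le_condExp_indicator_of_indep {Ω E F : Type*} {m mΩ : MeasurableSpace Ω} {μ : Measure Ω}
    [IsProbabilityMeasure μ] [MeasurableSpace E] [MeasurableSpace F] (hm : m ≤ mΩ) {a : Ω → E}
    {Z : Ω → F} (ha : Measurable[m] a) (hZ : Measurable Z)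
    (hind : Indep m (MeasurableSpace.comap Z inferInstance) μ) {K : Set E}
    (haK : ∀ᵐ ω ∂μ, a ω ∈ K) {S : Set (E × F)} (hS : MeasurableSet S) {p : ℝ}
    (hp : ∀ x ∈ K, p ≤ (μ.map Z).real (Prod.mk x ⁻¹' S)) :
    ∀ᵐ ω ∂μ, p ≤ (μ[Set.indicator {ω' | (a ω', Z ω') ∈ S} (fun _ => (1 : ℝ)) | m]) ω := by
  have ha' : Measurable a := ha.mono hm le_rfl
  have := Measure.isProbabilityMeasure_map (μ := μ) hZ.aemeasurable
  set A : Set Ω := {ω' | (a ω', Z ω') ∈ S}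
  have hA : MeasurableSet A := (ha'.prodMk hZ) hS
  have hint : Integrable (A.indicator fun _ => (1 : ℝ)) μ := (integrable_const _).indicator hA
  refine ae_le_of_ae_le_trim (hm := hm) (f₁ := fun _ => p) ?_
  refine ae_le_of_forall_setIntegral_le (integrable_const _)
    (integrable_condExp.trim hm stronglyMeasurable_condExp) fun B hB _ => ?_
  have hB' : MeasurableSet B := hm B hB
  rw [← setIntegral_trim hm stronglyMeasurable_const hB,
    ← setIntegral_trim hm stronglyMeasurable_condExp hB, setIntegral_condExp hm hint hB,
    setIntegral_indicator hA]
  simp only [integral_const, measureReal_restrict_apply_univ, smul_eq_mul, mul_one]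
  -- Both `B` and `a` belong to `m`, so restricting to `B` leaves `Z` independent of `a` and with
  -- the same law.
  have hprod : ((μ.restrict B).map a).prod (μ.map Z) = (μ.restrict B).map (fun ω => (a ω, Z ω)) := by
    refine Measure.prod_eq fun C D hC hD => ?_
    rw [Measure.map_apply (ha'.prodMk hZ) (hC.prod hD), Measure.map_apply ha' hC,
      Measure.map_apply hZ hD, Measure.restrict_apply ((ha'.prodMk hZ) (hC.prod hD)),
      Measure.restrict_apply (ha' hC), ← (Indep_iff _ _ _).1 hind _ _ ((ha hC).inter hB) ⟨D, hD, rfl⟩]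
    congr 1
    ext ω
    simp only [Set.mem_inter_iff, Set.mem_preimage, Set.mem_prod]
    tauto
  have hAB : μ (B ∩ A) = ∫⁻ ω in B, (μ.map Z) (Prod.mk (a ω) ⁻¹' S) ∂μ := by
    rw [← lintegral_map (f := fun x => (μ.map Z) (Prod.mk x ⁻¹' S))
      (measurable_measure_prodMk_left hS) ha', ← Measure.prod_apply hS, hprod,
      Measure.map_apply (ha'.prodMk hZ) hS, Measure.restrict_apply ((ha'.prodMk hZ) hS),
      Set.inter_comm]
    rfl
  have hle : ENNReal.ofReal p * μ B ≤ μ (B ∩ A) := by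
    rw [hAB, ← setLIntegral_const]
    refine lintegral_mono_ae (ae_restrict_of_ae ?_)
    filter_upwards [haK] with ω hω
    exact ENNReal.ofReal_le_of_le_toReal (hp _ hω)
  rcases le_or_gt p 0 with hp0 | hp0
  · exact (mul_nonpos_of_nonneg_of_nonpos measureReal_nonneg hp0).trans measureReal_nonneg
  have := ENNReal.toReal_mono (measure_ne_top _ _) hle
  rw [ENNReal.toReal_mul, ENNReal.toReal_ofReal hp0.le] at this
  rw [mul_comm]
  exact this

section System

variable {Ω : Type*} [mΩ : MeasurableSpace Ω] {μ : Measure Ω} [IsProbabilityMeasure μ]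
  {nx nu nφ : ℕ} {θ : Matrix (Fin nx) (Fin nφ) ℝ}
  {φ : (Fin nx → ℝ) × (Fin nu → ℝ) → Fin nφ → ℝ}
  {w : ℕ → Ω → Fin nx → ℝ} {u : ℕ → Ω → Fin nu → ℝ} {wmax umax : ℝ}

theorem map_pair_noise (hw : IsBoundedIIDSemicontinuous μ w wmax)
    (hu : IsBoundedIIDSemicontinuous μ u umax)
    (hwu : IndepFun (fun ω t => w t ω) (fun ω t => u t ω) μ) (s t : ℕ) :
    μ.map (fun ω => (w s ω, u t ω)) = (μ.map (w 0)).prod (μ.map (u 0)) := by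
  rw [(indepFun_iff_map_prod_eq_prod_map_map (hw.measurable s).aemeasurable
    (hu.measurable t).aemeasurable).1 (indepFun_pair_noise hwu s t),
    (hw.identDistrib s).map_eq, (hu.identDistrib t).map_eq]

theorem sqrt_dotProduct_smul_one_mulVec {n : ℕ} {s : ℝ} (hs : 0 ≤ s) {v : Fin n → ℝ}
    (hv : l2norm v = 1) :
    √(v ⬝ᵥ (s ^ 2 • (1 : Matrix (Fin n) (Fin n) ℝ)) *ᵥ v) = s := by
  have h : v ⬝ᵥ v = 1 := by
    have := l2norm_sq v
    rw [hv] at this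
    simp only [dotProduct, ← pow_two]
    linarith
  rw [Matrix.smul_mulVec, Matrix.one_mulVec, dotProduct_smul, h, smul_eq_mul, mul_one,
    Real.sqrt_sq hs]

theorem exists_isBMSB (hφ : IsAnalyticFeatureMap φ) (hw : IsBoundedIIDSemicontinuous μ w wmax)
    (hu : IsBoundedIIDSemicontinuous μ u umax)
    (hwu : IndepFun (fun ω t => w t ω) (fun ω t => u t ω) μ) {R : ℝ}
    (hx : ∀ᵐ ω ∂μ, ∀ t, ‖sysState θ φ w u t ω‖ ≤ R) :
    ∃ s p : ℝ, 0 < s ∧ 0 < p ∧ p < 1 ∧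
      IsBMSB μ (sysFiltration hw.measurable
          (measurable_sysState (θ := θ) hφ.measurable hw.measurable hu.measurable) hu.measurable)
        (sysFeature θ φ w u) 1 (s ^ 2 • (1 : Matrix (Fin nφ) (Fin nφ) ℝ)) p := by
  have := Measure.isProbabilityMeasure_map (μ := μ) (hw.measurable 0).aemeasurable
  have := Measure.isProbabilityMeasure_map (μ := μ) (hu.measurable 0).aemeasurable
  have hxw : ∀ᵐ ω ∂μ, ∀ t, ‖θ *ᵥ sysFeature θ φ w u t ω‖ ≤ R + wmax := by
    filter_upwards [hx, ae_all_iff.2 hw.bounded] with ω hx hw t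
    have h1 : θ *ᵥ sysFeature θ φ w u t ω = sysState θ φ w u (t + 1) ω - w t ω := by
      simp [sysState, sysMap, sysFeature]
    rw [h1]
    exact (norm_sub_le _ _).trans (add_le_add (hx _) (hw t))
  obtain ⟨s, p, hs, hp, hp1, h⟩ := hφ.exists_uniform_small_ball (hw.semicontinuous 0)
    (hu.semicontinuous 0) (ν₁ := μ.map (w 0)) (ν₂ := μ.map (u 0)) (r₁ := wmax) (r₂ := umax)
    ((ae_map_iff (hw.measurable 0).aemeasurable
      (measurableSet_le measurable_norm measurable_const)).2 (hw.bounded 0))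
    ((ae_map_iff (hu.measurable 0).aemeasurable
      (measurableSet_le measurable_norm measurable_const)).2 (hu.bounded 0)) (R + wmax)
  have hfeat : ∀ t, Measurable[sysFiltration hw.measurable
      (measurable_sysState (θ := θ) hφ.measurable hw.measurable hu.measurable) hu.measurable t]
      (sysFeature θ φ w u t) := by
    intro t
    refine hφ.measurable.comp (Measurable.prodMk ?_ ?_)
    · exact measurable_iff_comap_le.2
        (le_sup_of_le_left (le_sup_of_le_right (le_iSup₂_of_le t le_rfl le_rfl)))
    · exact measurable_iff_comap_le.2 (le_sup_of_le_right (le_iSup₂_of_le t le_rfl le_rfl))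
  refine ⟨s, p, hs, hp, hp1, one_pos, Matrix.PosDef.one.smul (by positivity), ⟨hp.le, hp1.le⟩,
    fun t _ => hfeat t, fun v hv t ht => ?_⟩
  have hθ : Measurable fun v : Fin nφ → ℝ => θ *ᵥ v :=
    (Continuous.matrix_mulVec continuous_const continuous_id).measurable
  have hc : Continuous fun y : (Fin nx → ℝ) × ((Fin nx → ℝ) × (Fin nu → ℝ)) =>
      v ⬝ᵥ φ (y.1 + y.2.1, y.2.2) :=
    continuous_const.dotProduct (hφ.continuous.comp (by fun_prop))
  -- Here `x_{t+1} = a + w_t` with `a = θ y_t` known at time `t`, and `(w_t, u_{t+1})` is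
  -- independent of `F_t`.
  have key := le_condExp_indicator_of_indep (μ := μ) ((sysFiltration hw.measurable
      (measurable_sysState (θ := θ) hφ.measurable hw.measurable hu.measurable) hu.measurable).le t)
    (a := fun ω => θ *ᵥ sysFeature θ φ w u t ω) (Z := fun ω => (w t ω, u (t + 1) ω))
    (hθ.comp (hfeat t)) ((hw.measurable t).prodMk (hu.measurable (t + 1))) ?_
    (K := Metric.closedBall 0 (R + wmax)) ?_
    (S := {y | s ≤ |v ⬝ᵥ φ (y.1 + y.2.1, y.2.2)|})
    (measurableSet_le measurable_const hc.measurable.abs) (p := p) ?_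
  · filter_upwards [key] with ω hω
    simp only [sqrt_dotProduct_smul_one_mulVec hs.le hv, Finset.Icc_self, Finset.sum_singleton]
    rw [Nat.cast_one, div_one, one_mul]
    exact hω
  · refine indep_of_indep_of_le_left (indep_of_indep_of_le_right
      (indep_noiseSigma hw.measurable hu.measurable hw.indep hu.indep hwu t) ?_)
      (sysFiltration_le_noiseSigma hφ.measurable _ _ _ t)
    exact (MeasurableSpace.comap_prodMk _ _).le
  · filter_upwards [hxw] with ω hω
    simpa using hω t
  · intro x hx
    rw [map_pair_noise hw hu hwu]
    exact h x v (by simpa using hx) hv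

end System

/-! ### Survival probabilities -/

theorem mul_measureReal_le_of_le_condExp {Ω : Type*} {m mΩ : MeasurableSpace Ω} {μ : Measure Ω}
    [IsFiniteMeasure μ] (hm : m ≤ mΩ) {A B : Set Ω} (hA : MeasurableSet A)
    (hB : MeasurableSet[m] B) {p : ℝ}
    (hp : ∀ᵐ ω ∂μ, p ≤ (μ[A.indicator (fun _ => (1 : ℝ)) | m]) ω) :
    p * μ.real B ≤ μ.real (B ∩ A) := by
  have hint : Integrable (A.indicator fun _ => (1 : ℝ)) μ := (integrable_const _).indicator hA
  calc p * μ.real B = ∫ _ in B, p ∂μ := by simp [mul_comm]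
    _ ≤ ∫ ω in B, (μ[A.indicator (fun _ => (1 : ℝ)) | m]) ω ∂μ :=
      setIntegral_mono_ae (integrable_const _).integrableOn integrable_condExp.integrableOn hp
    _ = ∫ ω in B, A.indicator (fun _ => (1 : ℝ)) ω ∂μ := setIntegral_condExp hm hint hB
    _ = μ.real (B ∩ A) := by simp [setIntegral_indicator hA]

/-- Suppose that, given the past up to time `t`, one of the disjoint events `P (t + 1)` and
`N (t + 1)` happens with probability at least `p`, and that `P' t` and `N' t` are independent of the
past and have probability at least `q`. Then `n` attempts at `P t ∩ P' t` or `N t ∩ N' t`, made at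
every other time, all fail with probability at most `(1 - p q) ^ n`. -/
theorem measureReal_forall_notMem_le {Ω : Type*} {mΩ : MeasurableSpace Ω} {μ : Measure Ω}
    [IsProbabilityMeasure μ] {F : Filtration ℕ mΩ} {P N P' N' : ℕ → Set Ω} {p q : ℝ}
    (hpq : p * q ≤ 1) (hq : 0 ≤ q)
    (hP : ∀ t, 1 ≤ t → MeasurableSet[F t] (P t)) (hN : ∀ t, 1 ≤ t → MeasurableSet[F t] (N t))
    (hPN : ∀ t, Disjoint (P t) (N t))
    (hP' : ∀ t, MeasurableSet[F (t + 1)] (P' t)) (hN' : ∀ t, MeasurableSet[F (t + 1)] (N' t))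
    (hPi : ∀ t B, MeasurableSet[F t] B → μ (B ∩ P' t) = μ B * μ (P' t))
    (hNi : ∀ t B, MeasurableSet[F t] B → μ (B ∩ N' t) = μ B * μ (N' t))
    (hPq : ∀ t, q ≤ μ.real (P' t)) (hNq : ∀ t, q ≤ μ.real (N' t))
    (hp : ∀ t, 1 ≤ t → ∀ᵐ ω ∂μ,
      p ≤ (μ[(P (t + 1) ∪ N (t + 1)).indicator (fun _ => (1 : ℝ)) | F t]) ω) (n : ℕ) :
    μ.real {ω | ∀ k < n, ω ∉ P (2 * k + 2) ∩ P' (2 * k + 2) ∪ N (2 * k + 2) ∩ N' (2 * k + 2)} ≤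
      (1 - p * q) ^ n := by
  set S : ℕ → Set Ω := fun n =>
    {ω | ∀ k < n, ω ∉ P (2 * k + 2) ∩ P' (2 * k + 2) ∪ N (2 * k + 2) ∩ N' (2 * k + 2)} with hS
  have hkill : ∀ t, 1 ≤ t → MeasurableSet[F (t + 1)] (P t ∩ P' t ∪ N t ∩ N' t) := fun t ht =>
    (((F.mono (Nat.le_succ t)) _ (hP t ht)).inter (hP' t)).union
      (((F.mono (Nat.le_succ t)) _ (hN t ht)).inter (hN' t))
  have hsucc : ∀ n, S (n + 1) = S n \
      (P (2 * n + 2) ∩ P' (2 * n + 2) ∪ N (2 * n + 2) ∩ N' (2 * n + 2)) := by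
    intro n
    ext ω
    simp only [hS, Set.mem_ofPred_eq, Nat.lt_succ_iff_lt_or_eq, or_imp, forall_and, forall_eq,
      Set.mem_sdiff]
  -- The last of the first `n` attempts is at time `2 n` and involves noise known only at time `2 n
  -- + 1`. The next attempt, at `2 n + 2`, is conditioned on exactly that time; this is why every
  -- other time is skipped.
  have hSm : ∀ n, MeasurableSet[F (2 * n + 1)] (S n) := by
    intro n
    induction n with
    | zero => simp [hS]
    | succ n ih =>
      rw [hsucc]
      exact (F.mono (by lia) _ ih).diff (hkill (2 * n + 2) (by lia))
  induction n with
  | zero => simp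
  | succ n ih =>
    change μ.real (S (n + 1)) ≤ _
    set t := 2 * n + 2 with ht
    set B := S n with hB
    have hBt : MeasurableSet[F t] B := F.mono (by lia) _ (hSm n)
    have hPt := hP t (by lia)
    have hNt := hN t (by lia)
    have h1 : p * μ.real B ≤ μ.real (B ∩ (P t ∪ N t)) :=
      mul_measureReal_le_of_le_condExp (F.le _) (F.le t _ (hPt.union hNt)) (hSm n)
        (hp (2 * n + 1) (by lia))
    have h2 : μ.real (B ∩ (P t ∪ N t)) = μ.real (B ∩ P t) + μ.real (B ∩ N t) := by
      rw [Set.inter_union_distrib_left, measureReal_union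
        ((hPN t).mono Set.inter_subset_right Set.inter_subset_right)
        (F.le t _ (hBt.inter hNt))]
    have h3 : μ.real (B ∩ (P t ∩ P' t ∪ N t ∩ N' t)) =
        μ.real (B ∩ P t) * μ.real (P' t) + μ.real (B ∩ N t) * μ.real (N' t) := by
      rw [Set.inter_union_distrib_left, ← Set.inter_assoc, ← Set.inter_assoc, measureReal_union
        ((hPN t).mono (fun ω h => h.1.2) (fun ω h => h.1.2))
        ((F.le t _ (hBt.inter hNt)).inter (F.le _ _ (hN' t)))]
      simp only [measureReal_def, hPi t _ (hBt.inter hPt), hNi t _ (hBt.inter hNt),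
        ENNReal.toReal_mul]
    have h4 : μ.real (S (n + 1)) = μ.real B - μ.real (B ∩ (P t ∩ P' t ∪ N t ∩ N' t)) := by
      rw [hsucc, ← measureReal_inter_add_sdiff (s := B) (F.le _ _ (hkill t (by lia)))]
      ring
    -- Only the sum of the two sign probabilities is controlled; since each sign is met by its noise
    -- event with probability at least `q`, the split does not matter.
    have h5 : μ.real (B ∩ P t) * q ≤ μ.real (B ∩ P t) * μ.real (P' t) :=
      mul_le_mul_of_nonneg_left (hPq t) measureReal_nonneg
    have h6 : μ.real (B ∩ N t) * q ≤ μ.real (B ∩ N t) * μ.real (N' t) :=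
      mul_le_mul_of_nonneg_left (hNq t) measureReal_nonneg
    have h7 : p * μ.real B * q ≤ (μ.real (B ∩ P t) + μ.real (B ∩ N t)) * q :=
      mul_le_mul_of_nonneg_right (h1.trans_eq h2) hq
    calc μ.real (S (n + 1)) ≤ (1 - p * q) * μ.real B := by rw [h4, h3]; linarith
      _ ≤ (1 - p * q) * (1 - p * q) ^ n := mul_le_mul_of_nonneg_left ih (by linarith)
      _ = _ := by ring

/-! ### A net of the unit sphere -/

/-- One unit vector is chosen in each occupied cell of a cubic grid of side `1 / M`. The net points
must lie on the sphere itself, as the small-ball condition concerns unit vectors. -/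
theorem exists_finset_sphere_net (n M : ℕ) (hM : 0 < M) :
    ∃ N : Finset (Fin n → ℝ), N.card ≤ (2 * M + 1) ^ n ∧ (∀ v ∈ N, l2norm v = 1) ∧
      ∀ v, l2norm v = 1 → ∃ v' ∈ N, ∀ i, |v i - v' i| ≤ 1 / M := by
  classical
  have hM' : (0 : ℝ) < M := by exact_mod_cast hM
  let c : (Fin n → ℝ) → Fin n → ℤ := fun v i => ⌊M * v i⌋
  have hex : ∀ k : Fin n → ℤ, ∃ v, (∃ x, l2norm x = 1 ∧ c x = k) → l2norm v = 1 ∧ c v = k := by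
    intro k
    by_cases h : ∃ x, l2norm x = 1 ∧ c x = k
    · exact ⟨h.choose, fun _ => h.choose_spec⟩
    · exact ⟨0, fun h' => absurd h' h⟩
  choose g hg using hex
  let cells : Finset (Fin n → ℤ) := Fintype.piFinset fun _ => Finset.Icc (-M : ℤ) M
  refine ⟨(cells.filter fun k => ∃ x, l2norm x = 1 ∧ c x = k).image g, ?_, ?_, ?_⟩
  · refine Finset.card_image_le.trans ((Finset.card_filter_le _ _).trans (le_of_eq ?_))
    rw [Fintype.card_piFinset_const, Int.card_Icc]
    congr 1
    lia
  · intro v hv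
    obtain ⟨k, hk, rfl⟩ := Finset.mem_image.1 hv
    exact (hg k (Finset.mem_filter.1 hk).2).1
  · intro v hv
    have hv' : ∃ x, l2norm x = 1 ∧ c x = c v := ⟨v, hv, rfl⟩
    refine ⟨g (c v), Finset.mem_image_of_mem g (Finset.mem_filter.2 ⟨?_, hv'⟩), fun i => ?_⟩
    · refine Fintype.mem_piFinset.2 fun i => Finset.mem_Icc.2 ?_
      have h1 := abs_le.1 ((abs_le_l2norm v i).trans_eq hv)
      constructor
      · refine Int.le_floor.2 ?_
        push_cast
        nlinarith [h1.1]
      · have h2 : (⌊M * v i⌋ : ℝ) ≤ M := (Int.floor_le _).trans (by nlinarith [h1.2])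
        exact_mod_cast h2
    · have h1 : ⌊M * g (c v) i⌋ = ⌊M * v i⌋ := congrFun (hg (c v) hv').2 i
      have h2 := Int.abs_sub_lt_one_of_floor_eq_floor h1.symm
      rw [← mul_sub, abs_mul, abs_of_pos hM'] at h2
      rw [le_div_iff₀ hM', mul_comm]
      exact h2.le

/-- Replacing `v'` by the true direction `x / ‖x‖₂` costs at most `s / 4`, so `v'·y ≥ s` would give
`x·y ≥ 3 s r / 4`, more than the allowed slack `g ≤ s r / 2`. -/
theorem not_and_le_of_dotProduct_le {n M : ℕ} {x y v' : Fin n → ℝ} {r s b g : ℝ} (hr : 0 < r)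
    (hs : 0 < s) (hx : r ≤ l2norm x) (hxy : x ⬝ᵥ y ≤ g) (hy : l2norm y ≤ b)
    (hMs : √n * (1 / M) * b ≤ s / 4)
    (hv : ∀ i, |((l2norm x)⁻¹ • x) i - v' i| ≤ 1 / M) :
    ¬ (s ≤ v' ⬝ᵥ y ∧ g ≤ s * r / 2) := by
  rintro ⟨h1, h2⟩
  have hx0 : 0 < l2norm x := hr.trans_le hx
  set v := (l2norm x)⁻¹ • x with hvdef
  have h3 : l2norm (v - v') ≤ √n * (1 / M) := by
    simpa using l2norm_le_sqrt_mul (v := v - v') (δ := 1 / M) (by positivity) hv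
  have h4 : |(v - v') ⬝ᵥ y| ≤ s / 4 :=
    (abs_dotProduct_le _ _).trans
      ((mul_le_mul h3 hy (l2norm_nonneg _) (by positivity)).trans hMs)
  have h5 : v ⬝ᵥ y ≤ s / 2 := by
    rw [hvdef, smul_dotProduct, smul_eq_mul, inv_mul_le_iff₀ hx0]
    nlinarith
  rw [sub_dotProduct] at h4
  have := (abs_le.1 h4).1
  linarith

theorem l2norm_inv_smul {n : ℕ} {x : Fin n → ℝ} (hx : 0 < l2norm x) :
    l2norm ((l2norm x)⁻¹ • x) = 1 := by
  rw [l2norm_smul, abs_of_pos (inv_pos.2 hx), inv_mul_cancel₀ hx.ne']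

/-! ### Consequences of the small-ball condition -/

section BMSB

variable {Ω : Type*} [mΩ : MeasurableSpace Ω] {μ : Measure Ω} {n : ℕ}
  {F : Filtration ℕ mΩ} {y : ℕ → Ω → Fin n → ℝ} {s p b : ℝ}

theorem IsBMSB.le_condExp (h : IsBMSB μ F y 1 (s ^ 2 • (1 : Matrix (Fin n) (Fin n) ℝ)) p)
    (hs : 0 ≤ s) {v : Fin n → ℝ} (hv : l2norm v = 1) {t : ℕ} (ht : 1 ≤ t) :
    ∀ᵐ ω ∂μ, p ≤ (μ[Set.indicator {ω' | s ≤ |v ⬝ᵥ y (t + 1) ω'|}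
      (fun _ => (1 : ℝ)) | F t]) ω := by
  filter_upwards [h.small_ball v hv t ht] with ω hω
  simpa only [sqrt_dotProduct_smul_one_mulVec hs hv, Finset.Icc_self, Finset.sum_singleton,
    Nat.cast_one, div_one, one_mul] using hω

theorem IsBMSB.measurable_dotProduct
    (h : IsBMSB μ F y 1 (s ^ 2 • (1 : Matrix (Fin n) (Fin n) ℝ)) p) (v : Fin n → ℝ) {t : ℕ}
    (ht : 1 ≤ t) : Measurable[F t] fun ω => v ⬝ᵥ y t ω :=
  (Continuous.dotProduct continuous_const continuous_id).measurable.comp (h.adapted t ht)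

variable [IsProbabilityMeasure μ]

theorem IsBMSB.le_measureReal (h : IsBMSB μ F y 1 (s ^ 2 • (1 : Matrix (Fin n) (Fin n) ℝ)) p)
    (hs : 0 ≤ s) {v : Fin n → ℝ} (hv : l2norm v = 1) :
    p ≤ μ.real {ω | s ≤ |v ⬝ᵥ y 2 ω|} := by
  have hA : MeasurableSet {ω | s ≤ |v ⬝ᵥ y 2 ω|} :=
    measurableSet_le measurable_const
      (((h.measurable_dotProduct v (t := 2) one_le_two).mono (F.le 2) le_rfl).abs)
  simpa using mul_measureReal_le_of_le_condExp (F.le 1) hA MeasurableSet.univ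
    (h.le_condExp hs hv le_rfl)

theorem l2norm_single {n : ℕ} (i : Fin n) : l2norm (Pi.single i (1 : ℝ)) = 1 := by
  simp [l2norm, Pi.single_apply, ite_pow]

theorem IsBMSB.le_bound (h : IsBMSB μ F y 1 (s ^ 2 • (1 : Matrix (Fin n) (Fin n) ℝ)) p)
    (hs : 0 ≤ s) (hp : 0 < p) (hn : 0 < n) (hb : ∀ᵐ ω ∂μ, ∀ t, l2norm (y t ω) ≤ b) : s ≤ b := by
  by_contra! hlt
  have h1 := h.le_measureReal hs (l2norm_single (⟨0, hn⟩ : Fin n))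
  have h2 : μ {ω | s ≤ |Pi.single (⟨0, hn⟩ : Fin n) (1 : ℝ) ⬝ᵥ y 2 ω|} = 0 := by
    refine measure_mono_null (fun ω hω => ?_) (ae_iff.1 hb)
    intro hall
    have h3 := (abs_dotProduct_le (Pi.single (⟨0, hn⟩ : Fin n) (1 : ℝ)) (y 2 ω))
    rw [l2norm_single, one_mul] at h3
    have h4 : s ≤ _ := hω
    linarith [hall 2]
  rw [measureReal_def, h2, ENNReal.toReal_zero] at h1
  linarith

/-- Apply the small-ball condition to each coordinate vector and sum the second moments: `n s² p ≤ E
‖y_2‖₂² ≤ b²`. This bounds the dimension by `b`, `s`, `p`, so that no separate `log n` arises from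
the net. -/
theorem IsBMSB.card_mul_le (h : IsBMSB μ F y 1 (s ^ 2 • (1 : Matrix (Fin n) (Fin n) ℝ)) p)
    (hs : 0 ≤ s) (hb : ∀ᵐ ω ∂μ, ∀ t, l2norm (y t ω) ≤ b) : n * (s ^ 2 * p) ≤ b ^ 2 := by
  have hA : ∀ i : Fin n, MeasurableSet {ω | s ≤ |y 2 ω i|} := fun i =>
    measurableSet_le measurable_const (((measurable_pi_apply i).comp
      ((h.adapted 2 one_le_two).mono (F.le 2) le_rfl)).abs)
  have h1 : ∀ i : Fin n, p ≤ μ.real {ω | s ≤ |y 2 ω i|} := by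
    intro i
    simpa using h.le_measureReal hs (l2norm_single i)
  have hint : ∀ i ∈ Finset.univ, Integrable
      ({ω | s ≤ |y 2 ω i|}.indicator fun _ => s ^ 2) μ := fun i _ =>
    (integrable_const _).indicator (hA i)
  calc n * (s ^ 2 * p) = ∑ _i : Fin n, s ^ 2 * p := by simp
    _ ≤ ∑ i : Fin n, ∫ ω, {ω | s ≤ |y 2 ω i|}.indicator (fun _ => s ^ 2) ω ∂μ := by
      refine Finset.sum_le_sum fun i _ => ?_
      rw [integral_indicator_const _ (hA i), smul_eq_mul, mul_comm]
      exact mul_le_mul_of_nonneg_right (h1 i) (sq_nonneg s)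
    _ = ∫ ω, ∑ i : Fin n, {ω | s ≤ |y 2 ω i|}.indicator (fun _ => s ^ 2) ω ∂μ :=
      (integral_finsetSum _ hint).symm
    _ ≤ ∫ _, b ^ 2 ∂μ := by
      refine integral_mono_ae (integrable_finsetSum _ hint) (integrable_const _) ?_
      filter_upwards [hb] with ω hω
      refine le_trans ?_ (pow_le_pow_left₀ (l2norm_nonneg _) (hω 2) 2)
      rw [l2norm_sq]
      refine Finset.sum_le_sum fun i _ => ?_
      refine Set.indicator_le' (f := fun _ => s ^ 2) (g := fun ω => y 2 ω i ^ 2)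
        (fun ω hω => ?_) (fun ω _ => sq_nonneg _) ω
      rw [← sq_abs (y 2 ω i)]
      exact pow_le_pow_left₀ hs hω 2
    _ = b ^ 2 := by simp

/-- In one direction `v`, all tests of the sign of `v ⬝ᵥ y t` fail with small probability. -/
theorem IsBMSB.measure_survival_le
    (h : IsBMSB μ F y 1 (s ^ 2 • (1 : Matrix (Fin n) (Fin n) ℝ)) p) (hs : 0 < s)
    {v : Fin n → ℝ} (hv : l2norm v = 1) {q : ℝ} (hq : 0 ≤ q) (hq1 : q ≤ 1) {P' N' : ℕ → Set Ω}
    (hP' : ∀ t, MeasurableSet[F (t + 1)] (P' t)) (hN' : ∀ t, MeasurableSet[F (t + 1)] (N' t))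
    (hPi : ∀ t B, MeasurableSet[F t] B → μ (B ∩ P' t) = μ B * μ (P' t))
    (hNi : ∀ t B, MeasurableSet[F t] B → μ (B ∩ N' t) = μ B * μ (N' t))
    (hPq : ∀ t, q ≤ μ.real (P' t)) (hNq : ∀ t, q ≤ μ.real (N' t)) (k : ℕ) :
    μ {ω | ∀ i < k, ¬ ((s ≤ v ⬝ᵥ y (2 * i + 2) ω ∧ ω ∈ P' (2 * i + 2)) ∨
      (v ⬝ᵥ y (2 * i + 2) ω ≤ -s ∧ ω ∈ N' (2 * i + 2)))} ≤
      ENNReal.ofReal (Real.exp (-(p * q * k))) := by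
  have hpq : p * q ≤ 1 := mul_le_one₀ h.p_mem.2 hq hq1
  have key := measureReal_forall_notMem_le (μ := μ) (F := F)
    (P := fun t => {ω | s ≤ v ⬝ᵥ y t ω}) (N := fun t => {ω | v ⬝ᵥ y t ω ≤ -s})
    hpq hq
    (fun t ht => measurableSet_le measurable_const (h.measurable_dotProduct v ht))
    (fun t ht => measurableSet_le (h.measurable_dotProduct v ht) measurable_const)
    (fun t => Set.disjoint_left.2 fun ω h1 h2 => by
      simp only [Set.mem_ofPred_eq] at h1 h2
      linarith) hP' hN' hPi hNi hPq hNq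
    (fun t ht => by
      have : ({ω | s ≤ v ⬝ᵥ y (t + 1) ω} ∪ {ω | v ⬝ᵥ y (t + 1) ω ≤ -s}) =
          {ω | s ≤ |v ⬝ᵥ y (t + 1) ω|} := by
        ext ω
        simp only [Set.mem_union, Set.mem_ofPred_eq, le_abs, le_neg]
      rw [this]
      exact h.le_condExp hs.le hv ht) k
  rw [← ofReal_measureReal (measure_ne_top _ _)]
  refine ENNReal.ofReal_le_ofReal (key.trans ?_)
  calc (1 - p * q) ^ k ≤ Real.exp (-(p * q)) ^ k :=
        pow_le_pow_left₀ (by linarith) (Real.one_sub_le_exp_neg _) k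
    _ = _ := by rw [← Real.exp_nat_mul]; congr 1; ring

end BMSB

/-! ### Probability that a wrong row remains unfalsified -/

section Rows

variable {Ω : Type*} [mΩ : MeasurableSpace Ω] {μ : Measure Ω} [IsProbabilityMeasure μ] {n d : ℕ}
  {F : Filtration ℕ mΩ} {y : ℕ → Ω → Fin n → ℝ} {w : ℕ → Ω → Fin d → ℝ} {s p b r W : ℝ}
  {qw : ℝ → ℝ} {M T k : ℕ}

/-- A vector `x` that is consistent with row `j` of the data passes all tests along a net point. -/
theorem exists_forall_not_of_row {N : Finset (Fin n → ℝ)}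
    (hN : ∀ v, l2norm v = 1 → ∃ v' ∈ N, ∀ i, |v i - v' i| ≤ 1 / M) (hs : 0 < s) (hr : 0 < r)
    (hMs : √n * (1 / M) * b ≤ s / 4) (hk : 2 * k < T) {y : ℕ → Fin n → ℝ} {e : ℕ → ℝ}
    (hy : ∀ t, l2norm (y t) ≤ b) {x : Fin n → ℝ} (hx : r ≤ l2norm x)
    (hxy : ∀ t < T, |e t - x ⬝ᵥ y t| ≤ W) :
    ∃ v ∈ N, ∀ i < k, ¬ ((s ≤ v ⬝ᵥ y (2 * i + 2) ∧ e (2 * i + 2) + W ≤ s * r / 2) ∨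
      (v ⬝ᵥ y (2 * i + 2) ≤ -s ∧ W - e (2 * i + 2) ≤ s * r / 2)) := by
  obtain ⟨v, hv, hvx⟩ := hN _ (l2norm_inv_smul (hr.trans_le hx))
  refine ⟨v, hv, fun i hi => ?_⟩
  have h1 := abs_le.1 (hxy (2 * i + 2) (by lia))
  have hy' := hy (2 * i + 2)
  rintro (h | h)
  · exact not_and_le_of_dotProduct_le hr hs hx (y := y (2 * i + 2)) (by linarith) hy' hMs hvx h
  · have hneg : l2norm (-y (2 * i + 2)) ≤ b := by simpa [l2norm] using hy'
    refine not_and_le_of_dotProduct_le hr hs hx (y := -y (2 * i + 2))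
      (g := W - e (2 * i + 2)) ?_ hneg hMs hvx ⟨?_, h.2⟩
    · rw [dotProduct_neg]; linarith
    · rw [dotProduct_neg]; linarith [h.1]

theorem IsBMSB.measure_exists_row_le
    (h : IsBMSB μ F y 1 (s ^ 2 • (1 : Matrix (Fin n) (Fin n) ℝ)) p) (hs : 0 < s) (hr : 0 < r)
    (hM : 0 < M) (hMs : √n * (1 / M) * b ≤ s / 4) (hk : 2 * k < T)
    (hy : ∀ᵐ ω ∂μ, ∀ t, l2norm (y t ω) ≤ b) (hwF : ∀ t, Measurable[F (t + 1)] (w t))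
    (hind : ∀ t, Indep (F t) (MeasurableSpace.comap (w t) inferInstance) μ)
    (hq : IsTightBound μ w W qw) (hq1 : qw (s * r / 2) ≤ 1) :
    μ {ω | ∃ (j : Fin d) (x : Fin n → ℝ), r ≤ l2norm x ∧
      ∀ t < T, |w t ω j - x ⬝ᵥ y t ω| ≤ W} ≤
    ENNReal.ofReal (d * ((2 * M + 1) ^ n * Real.exp (-(p * qw (s * r / 2) * k)))) := by
  obtain ⟨N, hcard, hunit, hN⟩ := exists_finset_sphere_net n M hM
  set q := qw (s * r / 2) with hqdef
  have hq0 : 0 ≤ q := (hq (s * r / 2) (by positivity)).1.le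
  have hE1 : ∀ j, MeasurableSet {z : Fin d → ℝ | z j + W ≤ s * r / 2} := fun j =>
    measurableSet_le (by fun_prop) measurable_const
  have hE2 : ∀ j, MeasurableSet {z : Fin d → ℝ | W - z j ≤ s * r / 2} := fun j =>
    measurableSet_le (by fun_prop) measurable_const
  have hone : ∀ (j : Fin d), ∀ v ∈ N,
      μ {ω | ∀ i < k, ¬ ((s ≤ v ⬝ᵥ y (2 * i + 2) ω ∧ w (2 * i + 2) ω j + W ≤ s * r / 2) ∨
      (v ⬝ᵥ y (2 * i + 2) ω ≤ -s ∧ W - w (2 * i + 2) ω j ≤ s * r / 2))} ≤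
      ENNReal.ofReal (Real.exp (-(p * q * k))) := fun j v hv =>
    h.measure_survival_le hs (hunit v hv) hq0 hq1
      (P' := fun t => {ω | w t ω j + W ≤ s * r / 2}) (N' := fun t => {ω | W - w t ω j ≤ s * r / 2})
      (fun t => hwF t (hE1 j)) (fun t => hwF t (hE2 j))
      (fun t B hB => (Indep_iff _ _ _).1 (hind t) _ _ hB ⟨_, hE1 j, rfl⟩)
      (fun t B hB => (Indep_iff _ _ _).1 (hind t) _ _ hB ⟨_, hE2 j, rfl⟩)
      (fun t => ((hq (s * r / 2) (by positivity)).2 j t).1)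
      (fun t => ((hq (s * r / 2) (by positivity)).2 j t).2) k
  calc _ ≤ μ (⋃ j : Fin d, ⋃ v ∈ N, {ω | ∀ i < k,
        ¬ ((s ≤ v ⬝ᵥ y (2 * i + 2) ω ∧ w (2 * i + 2) ω j + W ≤ s * r / 2) ∨
      (v ⬝ᵥ y (2 * i + 2) ω ≤ -s ∧ W - w (2 * i + 2) ω j ≤ s * r / 2))}) := by
        refine measure_mono_ae ?_
        filter_upwards [hy] with ω hω
        rintro ⟨j, x, hx, hxy⟩
        obtain ⟨v, hv, hvs⟩ := exists_forall_not_of_row hN hs hr hMs hk hω hx hxy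
        exact Set.mem_iUnion.2 ⟨j, Set.mem_biUnion hv hvs⟩
    _ ≤ ∑ _j : Fin d, ∑ _v ∈ N, ENNReal.ofReal (Real.exp (-(p * q * k))) :=
        (measure_iUnion_fintype_le _ _).trans <| Finset.sum_le_sum fun j _ =>
          (measure_biUnion_finset_le _ _).trans <| Finset.sum_le_sum fun v hv => hone j v hv
    _ = ENNReal.ofReal (d * (N.card * Real.exp (-(p * q * k)))) := by
        simp only [Finset.sum_const, Finset.card_univ, Fintype.card_fin, nsmul_eq_mul]
        rw [ENNReal.ofReal_mul (Nat.cast_nonneg _), ENNReal.ofReal_mul (Nat.cast_nonneg _),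
          ENNReal.ofReal_natCast, ENNReal.ofReal_natCast]
    _ ≤ _ := by
        refine ENNReal.ofReal_le_ofReal ?_
        have : (N.card : ℝ) ≤ (2 * M + 1) ^ n := by exact_mod_cast hcard
        gcongr

/-- A tightness value of one places every noise coordinate in both windows almost surely. The tests
then depend on the direction alone, which removes the factor `d` from the union bound. -/
theorem IsBMSB.measure_exists_row_le_of_eq_one
    (h : IsBMSB μ F y 1 (s ^ 2 • (1 : Matrix (Fin n) (Fin n) ℝ)) p) (hs : 0 < s) (hr : 0 < r)
    (hM : 0 < M) (hMs : √n * (1 / M) * b ≤ s / 4) (hk : 2 * k < T)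
    (hy : ∀ᵐ ω ∂μ, ∀ t, l2norm (y t ω) ≤ b) (hw : ∀ t, Measurable (w t))
    (hq : IsTightBound μ w W qw) (hq1 : 1 ≤ qw (s * r / 2)) :
    μ {ω | ∃ (j : Fin d) (x : Fin n → ℝ), r ≤ l2norm x ∧
      ∀ t < T, |w t ω j - x ⬝ᵥ y t ω| ≤ W} ≤
    ENNReal.ofReal ((2 * M + 1) ^ n * Real.exp (-(p * k))) := by
  obtain ⟨N, hcard, hunit, hN⟩ := exists_finset_sphere_net n M hM
  have hsure : ∀ᵐ ω ∂μ, ∀ t j, w t ω j + W ≤ s * r / 2 ∧ W - w t ω j ≤ s * r / 2 := by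
    have hae : ∀ A : Set Ω, MeasurableSet A → qw (s * r / 2) ≤ μ.real A → ∀ᵐ ω ∂μ, ω ∈ A := by
      intro A hA hle
      refine (mem_ae_iff_prob_eq_one hA).2 (le_antisymm prob_le_one ?_)
      rw [← ofReal_measureReal (measure_ne_top μ A), ← ENNReal.ofReal_one]
      exact ENNReal.ofReal_le_ofReal (hq1.trans hle)
    rw [ae_all_iff]
    intro t
    rw [ae_all_iff]
    intro j
    have hm : Measurable fun ω => w t ω j := (measurable_pi_apply j).comp (hw t)
    have h1 := (hq (s * r / 2) (by positivity)).2 j t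
    exact (hae _ (measurableSet_le (hm.add_const W) measurable_const) h1.1).and
      (hae _ (measurableSet_le (measurable_const.sub hm) measurable_const) h1.2)
  have hone : ∀ v ∈ N,
      μ {ω | ∀ i < k, ¬ ((s ≤ v ⬝ᵥ y (2 * i + 2) ω ∧ ω ∈ (Set.univ : Set Ω)) ∨
      (v ⬝ᵥ y (2 * i + 2) ω ≤ -s ∧ ω ∈ (Set.univ : Set Ω)))} ≤
      ENNReal.ofReal (Real.exp (-(p * k))) := fun v hv => by
    simpa only [mul_one] using h.measure_survival_le hs (hunit v hv) zero_le_one le_rfl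
      (P' := fun _ => Set.univ) (N' := fun _ => Set.univ)
      (fun t => MeasurableSet.univ) (fun t => MeasurableSet.univ)
      (fun t B hB => by simp) (fun t B hB => by simp) (fun t => by simp) (fun t => by simp) k
  calc _ ≤ μ (⋃ v ∈ N, {ω | ∀ i < k,
        ¬ ((s ≤ v ⬝ᵥ y (2 * i + 2) ω ∧ ω ∈ (Set.univ : Set Ω)) ∨
      (v ⬝ᵥ y (2 * i + 2) ω ≤ -s ∧ ω ∈ (Set.univ : Set Ω)))}) := by
        refine measure_mono_ae ?_
        filter_upwards [hy, hsure] with ω hω hωs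
        rintro ⟨j, x, hx, hxy⟩
        obtain ⟨v, hv, hvs⟩ := exists_forall_not_of_row hN hs hr hMs hk hω hx hxy
        refine Set.mem_biUnion hv fun i hi hor => hvs i hi ?_
        exact hor.imp (fun h => ⟨h.1, (hωs _ j).1⟩) fun h => ⟨h.1, (hωs _ j).2⟩
    _ ≤ ∑ _v ∈ N, ENNReal.ofReal (Real.exp (-(p * k))) :=
        (measure_biUnion_finset_le _ _).trans <| Finset.sum_le_sum hone
    _ = ENNReal.ofReal (N.card * Real.exp (-(p * k))) := by
        simp only [Finset.sum_const, nsmul_eq_mul]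
        rw [ENNReal.ofReal_mul (Nat.cast_nonneg _), ENNReal.ofReal_natCast]
    _ ≤ _ := by
        refine ENNReal.ofReal_le_ofReal ?_
        have : (N.card : ℝ) ≤ (2 * M + 1) ^ n := by exact_mod_cast hcard
        gcongr

end Rows

/-! ### From the diameter to rows -/

theorem frobNorm_sub_sq_le {d n : ℕ} (A B : Matrix (Fin d) (Fin n) ℝ) {r : ℝ}
    (hA : ∀ j, l2norm (A j) ≤ r) (hB : ∀ j, l2norm (B j) ≤ r) :
    frobNorm (A - B) ^ 2 ≤ d * (2 * r) ^ 2 := by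
  have hsq : frobNorm (A - B) ^ 2 = ∑ i, ∑ j, (A - B) i j ^ 2 :=
    Real.sq_sqrt (Finset.sum_nonneg fun _ _ => Finset.sum_nonneg fun _ _ => sq_nonneg _)
  rw [hsq]
  calc ∑ i, ∑ j, (A - B) i j ^ 2 ≤ ∑ _i : Fin d, (2 * r) ^ 2 := by
        refine Finset.sum_le_sum fun i _ => ?_
        have h1 := pow_le_pow_left₀ (l2norm_nonneg _) (hA i) 2
        have h2 := pow_le_pow_left₀ (l2norm_nonneg _) (hB i) 2
        rw [l2norm_sq] at h1 h2
        calc ∑ j, (A - B) i j ^ 2 ≤ ∑ j, (2 * A i j ^ 2 + 2 * B i j ^ 2) := by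
              refine Finset.sum_le_sum fun j _ => ?_
              rw [Matrix.sub_apply]
              nlinarith [sq_nonneg (A i j + B i j)]
          _ = 2 * ∑ j, A i j ^ 2 + 2 * ∑ j, B i j ^ 2 := by
              rw [Finset.sum_add_distrib, Finset.mul_sum, Finset.mul_sum]
          _ ≤ _ := by linarith
    _ = _ := by simp

/-- If all rows of `θ' - θ` were shorter than `r` for every `θ'` in `S`, two elements of `S` would
differ by at most `2 r` in each of `d` rows, hence by at most `2 √d r`. -/
theorem exists_row_of_lt_frobDiam {d n : ℕ} {S : Set (Matrix (Fin d) (Fin n) ℝ)} {r : ℝ}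
    (hr : 0 ≤ r) (h : ENNReal.ofReal (2 * √d * r) < frobDiam S) (θ : Matrix (Fin d) (Fin n) ℝ) :
    ∃ θ' ∈ S, ∃ j, r ≤ l2norm ((θ' - θ) j) := by
  simp only [frobDiam, lt_iSup_iff] at h
  obtain ⟨θ₁, h₁, θ₂, h₂, hlt⟩ := h
  have hlt' := (ENNReal.ofReal_lt_ofReal_iff_of_nonneg (by positivity)).1 hlt
  by_contra! hcon
  have h3 := frobNorm_sub_sq_le (θ₁ - θ) (θ₂ - θ) (fun j => (hcon θ₁ h₁ j).le)
    (fun j => (hcon θ₂ h₂ j).le)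
  rw [sub_sub_sub_cancel_right] at h3
  have h4 : (2 * √d * r) ^ 2 = d * (2 * r) ^ 2 := by
    rw [mul_pow, mul_pow, Real.sq_sqrt (Nat.cast_nonneg d)]
    ring
  have h5 := pow_lt_pow_left₀ hlt' (by positivity) two_ne_zero
  linarith

/-! ### Numerical estimates -/

section Numeric

variable {n : ℕ} {s p b : ℝ}

theorem net_estimates (hn : 0 < n) (hs : 0 < s) (hp : 0 < p) (hp1 : p ≤ 1) (hsb : s ≤ b)
    (hnb : n * (s ^ 2 * p) ≤ b ^ 2) :
    0 < ⌈4 * √n * b / s⌉₊ ∧ √n * (1 / ⌈4 * √n * b / s⌉₊) * b ≤ s / 4 ∧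
      2 * (⌈4 * √n * b / s⌉₊ : ℝ) + 1 ≤ 12 * (b / (s * p)) ^ 2 := by
  have hb : 0 < b := hs.trans_le hsb
  have hn' : (1 : ℝ) ≤ n := by exact_mod_cast hn
  have hsqrt : 1 ≤ √(n : ℝ) := Real.one_le_sqrt.2 hn'
  set z := √n * b / s with hz
  have hz1 : 1 ≤ z := by
    rw [hz, le_div_iff₀ hs]
    nlinarith
  have hM0 : 0 < ⌈4 * √n * b / s⌉₊ := Nat.ceil_pos.2 (by positivity)
  have hM0' : (0 : ℝ) < ⌈4 * √n * b / s⌉₊ := by exact_mod_cast hM0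
  have hMge := Nat.le_ceil (4 * √n * b / s)
  have hMle := Nat.ceil_lt_add_one (a := 4 * √n * b / s) (by positivity)
  have h4z : 4 * √n * b / s = 4 * z := by rw [hz]; ring
  refine ⟨hM0, ?_, ?_⟩
  · rw [div_le_iff₀ hs] at hMge
    rw [mul_one_div, div_mul_eq_mul_div, div_le_iff₀ hM0']
    linarith
  -- Squared, this is `n b² / s² ≤ (b / (s p))⁴`, a consequence of `n s² p ≤ b²` and `p ≤ 1`. With
  -- `z ≥ 1`, it gives `2 M + 1 ≤ 8 z + 3 ≤ 12 z`.
  · have hzX : z ≤ (b / (s * p)) ^ 2 := by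
      refine (sq_le_sq₀ (by positivity) (by positivity)).1 ?_
      have h1 : z ^ 2 = n * b ^ 2 / s ^ 2 := by
        rw [hz, div_pow, mul_pow, Real.sq_sqrt (by positivity)]
      have h2 : ((b / (s * p)) ^ 2) ^ 2 = b ^ 2 * b ^ 2 / (s ^ 2 * (s ^ 2 * p * p ^ 3)) := by
        field_simp
      rw [h1, h2, div_le_div_iff₀ (by positivity) (by positivity)]
      have h3 : p ^ 3 ≤ 1 := pow_le_one₀ hp.le hp1
      calc n * b ^ 2 * (s ^ 2 * (s ^ 2 * p * p ^ 3))
          = (n * (s ^ 2 * p)) * (b ^ 2 * s ^ 2) * p ^ 3 := by ring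
        _ ≤ b ^ 2 * (b ^ 2 * s ^ 2) * 1 := by gcongr
        _ = b ^ 2 * b ^ 2 * s ^ 2 := by ring
    linarith

variable {X ε k T Q : ℝ}

theorem pow_mul_exp_le_of_log_le (hQ0 : 0 < Q) (hε : 0 < ε) {c : ℝ}
    (h : n * Real.log Q + Real.log (1 / ε) ≤ c) : Q ^ n * Real.exp (-c) ≤ ε := by
  have h1 : Q ^ n = Real.exp (n * Real.log Q) := by
    rw [Real.exp_nat_mul, Real.exp_log hQ0]
  rw [h1, ← Real.exp_add]
  calc Real.exp (n * Real.log Q + -c) ≤ Real.exp (Real.log ε) := by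
        apply Real.exp_le_exp.2
        rw [one_div, Real.log_inv] at h
        linarith
    _ = ε := Real.exp_log hε

theorem log_net_le (hX : 1 ≤ X) (hQ0 : 0 < Q) (hQ : Q ≤ 12 * X ^ 2) :
    Real.log Q ≤ Real.log 12 + 2 * Real.log X := by
  refine (Real.log_le_log hQ0 hQ).trans_eq ?_
  rw [Real.log_mul (by norm_num) (by positivity), Real.log_pow]
  norm_num

theorem log_twelve_le : Real.log 12 ≤ 4 * Real.log 2 := by
  have : 4 * Real.log 2 = Real.log (2 ^ 4) := by rw [Real.log_pow]; norm_num
  rw [this]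
  exact Real.log_le_log (by norm_num) (by norm_num)

/-- The constant `8` is spent here: with `k ≥ T / 4` and `p² ≤ p` it leaves `p k ≥ 2 (log (1/ε) + n
log (8 X))`, and the factor `2` matches the exponent in `Q ≤ 12 X²`. -/
theorem net_mul_exp_le_of_hits (hε : 0 < ε) (hp : 0 < p) (hp1 : p ≤ 1) (hX : 1 ≤ X)
    (hQ0 : 0 < Q) (hQ : Q ≤ 12 * X ^ 2) (hlog : 0 ≤ Real.log (1 / ε)) (hT : 1 ≤ T)
    (hcond : 8 * ((Real.log (T / ε) + n * Real.log (8 * X)) / p ^ 2) ≤ T) (hk : T / 4 ≤ k) :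
    Q ^ n * Real.exp (-(p * k)) ≤ ε := by
  refine pow_mul_exp_le_of_log_le hQ0 hε ?_
  have hlogX : 0 ≤ Real.log X := Real.log_nonneg hX
  have h8 : Real.log (8 * X) = 3 * Real.log 2 + Real.log X := by
    rw [Real.log_mul (by norm_num) (by positivity)]
    congr 1
    rw [show (8 : ℝ) = 2 ^ 3 by norm_num, Real.log_pow]
    norm_num
  have h2 : 0 < Real.log 2 := Real.log_pos (by norm_num)
  have hTε : Real.log (1 / ε) ≤ Real.log (T / ε) :=
    Real.log_le_log (by positivity) (by gcongr)
  have hn0 : (0 : ℝ) ≤ n := Nat.cast_nonneg n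
  have hA : 0 ≤ Real.log (1 / ε) + n * Real.log (8 * X) := by
    rw [h8]
    positivity
  have hc : 8 * (Real.log (1 / ε) + n * Real.log (8 * X)) ≤ T * p ^ 2 := by
    rw [← mul_div_assoc, div_le_iff₀ (by positivity)] at hcond
    linarith
  have hpp : T * p ^ 2 ≤ T * p := by
    have : p ^ 2 ≤ p := by nlinarith
    gcongr
  have hpk : T * p / 4 ≤ p * k := by nlinarith
  have hlogQ := mul_le_mul_of_nonneg_left (log_net_le hX hQ0 hQ) hn0
  have h12 := mul_le_mul_of_nonneg_left log_twelve_le hn0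
  have hnX : 0 ≤ n * Real.log X := by positivity
  have hn2 : 0 ≤ n * Real.log 2 := by positivity
  rw [h8] at hc
  nlinarith

theorem rows_mul_net_mul_exp_le {d : ℕ} (hn : 0 < n) (hd : 0 < d) (hε : 0 < ε) (hε2 : ε ≤ 1 / 2)
    (hX : 1 ≤ X) (hnX : n ≤ X ^ 2) (hQ0 : 0 < Q) (hQ : Q ≤ 12 * X ^ 2) {c : ℝ}
    (hc : 12 * (Real.log (1 / ε) + d * n * Real.log (d * X)) ≤ c) :
    d * (Q ^ n * Real.exp (-c)) ≤ ε := by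
  have hd1 : (1 : ℝ) ≤ d := by exact_mod_cast hd
  have hn1 : (1 : ℝ) ≤ n := by exact_mod_cast hn
  have hd0 : (0 : ℝ) < d := by linarith
  rw [mul_comm, ← le_div_iff₀ hd0]
  refine pow_mul_exp_le_of_log_le hQ0 (by positivity) ?_
  have hlogX : 0 ≤ Real.log X := Real.log_nonneg hX
  have hlogd : 0 ≤ Real.log d := Real.log_nonneg hd1
  have h2 : 0 < Real.log 2 := Real.log_pos (by norm_num)
  have hε' : Real.log 2 ≤ Real.log (1 / ε) := by
    apply Real.log_le_log (by norm_num)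
    rw [le_div_iff₀ hε]
    linarith
  have h1 : Real.log (1 / (ε / d)) = Real.log (1 / ε) + Real.log d := by
    rw [one_div_div, ← Real.log_mul (by positivity) (by positivity)]
    congr 1
    ring
  have hdX : Real.log (d * X) = Real.log d + Real.log X :=
    Real.log_mul (by positivity) (by positivity)
  have hnX0 : 0 ≤ n * Real.log X := by positivity
  -- The constant `12` must be absorbed although `log X` may vanish. For `n = 1` it goes into `log
  -- (1/ε) ≥ log 2`; for `n ≥ 2` the inequality `n ≤ X²` keeps `log X` away from zero.
  have h12 : n * Real.log 12 ≤ 4 * Real.log (1 / ε) + 8 * (n * Real.log X) := by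
    rcases (Nat.succ_le_of_lt hn).eq_or_lt with h | h
    · rw [← h]
      push_cast
      have := log_twelve_le
      rw [← h] at hnX0
      push_cast at hnX0
      linarith
    · have hn2 : (2 : ℝ) ≤ n := by exact_mod_cast h
      have h3 : Real.log 2 ≤ 2 * Real.log X := by
        have := Real.log_le_log (by norm_num) (hn2.trans hnX)
        rwa [Real.log_pow, Nat.cast_two] at this
      have h4 : n * Real.log 12 ≤ n * (8 * Real.log X) := by
        have := log_twelve_le
        gcongr
        linarith
      linarith
  have hlogQ := mul_le_mul_of_nonneg_left (log_net_le hX hQ0 hQ) (Nat.cast_nonneg (α := ℝ) n)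
  have hmul : n * Real.log X + Real.log d ≤ d * n * Real.log (d * X) := by
    rw [hdX]
    have e1 : n * Real.log X ≤ d * (n * Real.log X) := le_mul_of_one_le_left hnX0 hd1
    have e2 : Real.log d ≤ d * n * Real.log d :=
      le_mul_of_one_le_left hlogd (one_le_mul_of_one_le_of_one_le hd1 hn1)
    linarith
  rw [h1]
  linarith

end Numeric

/-! ### The diameter of the set-membership estimate -/

theorem rpow_three_halves {x : ℝ} (hx : 0 ≤ x) : x ^ (3 / 2 : ℝ) = x * √x := by
  rw [Real.sqrt_eq_rpow, show (3 / 2 : ℝ) = 1 + 1 / 2 by norm_num,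
    Real.rpow_add_of_nonneg hx zero_le_one (by norm_num), Real.rpow_one]

theorem frobDiam_eq_zero_of_subsingleton {m n : ℕ} [Subsingleton (Matrix (Fin m) (Fin n) ℝ)]
    (S : Set (Matrix (Fin m) (Fin n) ℝ)) : frobDiam S = 0 := by
  simp only [frobDiam, ENNReal.iSup_eq_zero]
  intro θ _ θ' _
  rw [Subsingleton.elim (θ - θ') 0]
  simp [frobNorm]

section Main

variable {Ω : Type*} {nx nu nφ : ℕ} {θ : Matrix (Fin nx) (Fin nφ) ℝ}
  {φ : (Fin nx → ℝ) × (Fin nu → ℝ) → Fin nφ → ℝ}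
  {w : ℕ → Ω → Fin nx → ℝ} {u : ℕ → Ω → Fin nu → ℝ}

theorem exists_row_of_lt_frobDiam_smeSet {W r : ℝ} (hr : 0 ≤ r) {T : ℕ} {ω : Ω}
    (h : ENNReal.ofReal (2 * √nx * r) < frobDiam (smeSet {v | ‖v‖ ≤ W} φ
      (fun t => sysState θ φ w u t ω) (fun t => u t ω) T)) :
    ∃ (j : Fin nx) (x : Fin nφ → ℝ), r ≤ l2norm x ∧
      ∀ t < T, |w t ω j - x ⬝ᵥ sysFeature θ φ w u t ω| ≤ W := by
  obtain ⟨θ', hθ', j, hj⟩ := exists_row_of_lt_frobDiam hr h θ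
  refine ⟨j, _, hj, fun t ht => ?_⟩
  have h1 : ‖sysState θ φ w u (t + 1) ω - θ' *ᵥ sysFeature θ φ w u t ω‖ ≤ W := by
    simp only [smeSet, Set.mem_iInter] at hθ'
    exact hθ' t (Finset.mem_range.2 ht)
  have h2 : sysState θ φ w u (t + 1) ω - θ' *ᵥ sysFeature θ φ w u t ω =
      w t ω - (θ' - θ) *ᵥ sysFeature θ φ w u t ω := by
    have : sysState θ φ w u (t + 1) ω = θ *ᵥ sysFeature θ φ w u t ω + w t ω := rfl
    rw [this, Matrix.sub_mulVec]
    abel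
  rw [h2] at h1
  exact (norm_le_pi_norm _ j).trans h1

variable [mΩ : MeasurableSpace Ω] {μ : Measure Ω} [IsProbabilityMeasure μ]

theorem measure_lt_frobDiam_le {F : Filtration ℕ mΩ} {wmax cw s p b ε : ℝ} {T : ℕ}
    (hs : 0 < s) (hp : 0 < p) (hcw : 0 < cw)
    (h : IsBMSB μ F (sysFeature θ φ w u) 1 (s ^ 2 • (1 : Matrix (Fin nφ) (Fin nφ) ℝ)) p)
    (hb : ∀ᵐ ω ∂μ, ∀ t, l2norm (sysFeature θ φ w u t ω) ≤ b)
    (hw : ∀ t, Measurable (w t)) (hwF : ∀ t, Measurable[F (t + 1)] (w t))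
    (hind : ∀ t, Indep (F t) (MeasurableSpace.comap (w t) inferInstance) μ)
    (htight : IsTightBound μ w wmax fun ℓ => min (cw * ℓ) 1) (hε : 0 < ε)
    (hT : 8 * ((Real.log (T / ε) + nφ * Real.log (8 * b / (s * p))) / p ^ 2) ≤ T) :
    μ {ω | ENNReal.ofReal (200 * ((√nx * Real.log (1 / ε) +
            (nx : ℝ) ^ (3 / 2 : ℝ) * nφ * Real.log (b * nx / (s * p))) / (cw * s * p * T))) <
          frobDiam (smeSet {v | ‖v‖ ≤ wmax} φ
            (fun t => sysState θ φ w u t ω) (fun t => u t ω) T)} ≤ ENNReal.ofReal (2 * ε) := by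
  have hzero : Subsingleton (Matrix (Fin nx) (Fin nφ) ℝ) → μ {ω | ENNReal.ofReal (200 *
      ((√nx * Real.log (1 / ε) + (nx : ℝ) ^ (3 / 2 : ℝ) * nφ * Real.log (b * nx / (s * p))) /
        (cw * s * p * T))) < frobDiam (smeSet {v | ‖v‖ ≤ wmax} φ
            (fun t => sysState θ φ w u t ω) (fun t => u t ω) T)} ≤ ENNReal.ofReal (2 * ε) := by
    intro _
    simp [frobDiam_eq_zero_of_subsingleton]
  rcases Nat.eq_zero_or_pos nx with rfl | hnx
  · exact hzero (Matrix.subsingleton_of_empty_left)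
  rcases Nat.eq_zero_or_pos nφ with rfl | hnφ
  · exact hzero (Matrix.subsingleton_of_empty_right)
  -- For `ε ≥ 1 / 2` the bound `2 ε` on a probability is trivial; otherwise `log (1/ε)` is at least
  -- `log 2`.
  rcases le_or_gt (1 / 2) ε with hε2 | hε2
  · refine prob_le_one.trans ?_
    rw [← ENNReal.ofReal_one]
    exact ENNReal.ofReal_le_ofReal (by linarith)
  have hp1 : p ≤ 1 := h.p_mem.2
  have hsb : s ≤ b := h.le_bound hs.le hp hnφ hb
  have hnb := h.card_mul_le hs.le hb
  obtain ⟨hM0, hMs, hMX⟩ := net_estimates hnφ hs hp hp1 hsb hnb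
  set M := ⌈4 * √nφ * b / s⌉₊ with hM
  set X := b / (s * p) with hXdef
  have hX : 1 ≤ X := by
    rw [hXdef, one_le_div (by positivity)]
    nlinarith
  have hnX : (nφ : ℝ) ≤ X ^ 2 := by
    rw [hXdef, div_pow, le_div_iff₀ (by positivity)]
    refine le_trans ?_ hnb
    rw [mul_pow]
    have : p ^ 2 ≤ p := by nlinarith
    gcongr
  have hQ0 : (0 : ℝ) < 2 * M + 1 := by positivity
  rw [mul_div_assoc] at hT
  change 8 * ((Real.log (T / ε) + nφ * Real.log (8 * X)) / p ^ 2) ≤ T at hT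
  have hnφ1 : (1 : ℝ) ≤ nφ := by exact_mod_cast hnφ
  have hnx1 : (1 : ℝ) ≤ nx := by exact_mod_cast hnx
  have hlog2 : 1 / 2 < Real.log 2 := by linarith [Real.log_two_gt_d9]
  have hlog8 : 1 ≤ Real.log (8 * X) := by
    have h1 : Real.log (2 ^ 2) ≤ Real.log (8 * X) := Real.log_le_log (by norm_num) (by linarith)
    rw [Real.log_pow] at h1
    push_cast at h1
    linarith
  have hnlog : 1 ≤ nφ * Real.log (8 * X) := one_le_mul_of_one_le_of_one_le hnφ1 hlog8
  have hp2 : 0 < p ^ 2 := by positivity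
  have hp2' : p ^ 2 ≤ 1 := pow_le_one₀ hp.le hp1
  have hlogε : Real.log 2 ≤ Real.log (1 / ε) := by
    apply Real.log_le_log (by norm_num)
    rw [le_div_iff₀ hε]
    linarith
  rw [← mul_div_assoc, div_le_iff₀ hp2] at hT
  -- For `T = 0` the convention `log 0 = 0` leaves `8 nφ log (8 X) ≤ 0`, contradicting `hnlog`.
  have hT1 : 1 ≤ T := by
    by_contra! hlt
    have hT0 : T = 0 := by lia
    simp only [hT0, Nat.cast_zero, zero_div, Real.log_zero, zero_mul] at hT
    linarith
  have hT1' : (1 : ℝ) ≤ T := by exact_mod_cast hT1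
  have hlogT : Real.log (1 / ε) ≤ Real.log (T / ε) :=
    Real.log_le_log (by positivity) (by gcongr)
  have hT8 : (8 : ℝ) ≤ T := by nlinarith
  have hT0 : (0 : ℝ) < T := by linarith
  -- This counts the even times from `2` to `T - 1`; since `T ≥ 8`, there are at least `T / 4` of
  -- them.
  set k := (T - 1) / 2 with hk
  have hkT : 2 * k < T := by lia
  have hk4 : (T : ℝ) / 4 ≤ k := by
    have : T ≤ 2 * k + 2 := by lia
    have : (T : ℝ) ≤ 2 * k + 2 := by exact_mod_cast this
    linarith
  set Λ := Real.log (1 / ε) + nx * nφ * Real.log (nx * X) with hΛ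
  have hlognX : 0 ≤ Real.log (nx * X) :=
    Real.log_nonneg (one_le_mul_of_one_le_of_one_le hnx1 hX)
  have hΛ0 : 0 < Λ := by
    have : 0 ≤ nx * nφ * Real.log (nx * X) := by positivity
    linarith
  -- With `k ≥ T / 4`, the exponent `p (cw s r / 2) k` is at least `100 Λ / 8 = 12.5 Λ`, above the
  -- `12 Λ` needed. The factor `2 √nx` from rows to the diameter then gives `200`.
  set r := 100 * Λ / (cw * s * p * T) with hr
  have hr0 : 0 < r := by positivity
  have hD : 200 * ((√nx * Real.log (1 / ε) +
      (nx : ℝ) ^ (3 / 2 : ℝ) * nφ * Real.log (b * nx / (s * p))) / (cw * s * p * T)) =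
      2 * √nx * r := by
    rw [rpow_three_halves (Nat.cast_nonneg nx), hr, hΛ,
      show b * nx / (s * p) = nx * X by rw [hXdef]; ring]
    ring
  rw [hD]
  have hsub := measure_mono (μ := μ) (s := {ω | ENNReal.ofReal (2 * √nx * r) <
    frobDiam (smeSet {v | ‖v‖ ≤ wmax} φ (fun t => sysState θ φ w u t ω) (fun t => u t ω) T)})
    fun ω hω => exists_row_of_lt_frobDiam_smeSet hr0.le hω
  refine hsub.trans ?_
  -- Where the tightness function is capped, a larger `r` no longer helps and the exponent is only
  -- `p k`, controlled by the lower bound on `T`; below the cap it is proportional to `r`.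
  rcases le_or_gt 1 (cw * (s * r / 2)) with hq | hq
  · refine (h.measure_exists_row_le_of_eq_one hs hr0 hM0 hMs hkT hb hw htight
      (le_min hq le_rfl)).trans (ENNReal.ofReal_le_ofReal ?_)
    have := net_mul_exp_le_of_hits (n := nφ) hε hp hp1 hX hQ0 hMX (by linarith) hT1'
      (by rwa [← mul_div_assoc, div_le_iff₀ hp2]) hk4
    linarith
  · refine (h.measure_exists_row_le hs hr0 hM0 hMs hkT hb hwF hind htight
      (min_le_right _ _)).trans (ENNReal.ofReal_le_ofReal ?_)
    have hc : 12 * (Real.log (1 / ε) + nx * nφ * Real.log (nx * X)) ≤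
        p * min (cw * (s * r / 2)) 1 * k := by
      rw [min_eq_left hq.le]
      have h1 : p * (cw * (s * r / 2)) * (T / 4) = 12.5 * Λ := by
        rw [hr]
        field_simp
        ring
      have h2 : p * (cw * (s * r / 2)) * (T / 4) ≤ p * (cw * (s * r / 2)) * k := by gcongr
      linarith
    have := rows_mul_net_mul_exp_le hnφ hnx hε hε2.le hX hnX hQ0 hMX hc
    linarith

end Main

theorem corollary2 :
    ∃ K C : ℝ, 0 < K ∧ 0 < C ∧
      ∀ (Ω : Type*) [MeasurableSpace Ω] (μ : Measure Ω) [IsProbabilityMeasure μ]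
        (nx nu nφ : ℕ) (θ : Matrix (Fin nx) (Fin nφ) ℝ)
        (φ : (Fin nx → ℝ) × (Fin nu → ℝ) → Fin nφ → ℝ)
        (w : ℕ → Ω → Fin nx → ℝ) (u : ℕ → Ω → Fin nu → ℝ) (wmax umax ρx ρ cw : ℝ)
        (hφ : IsAnalyticFeatureMap φ)
        (hw : IsBoundedIIDSemicontinuous μ w wmax)
        (hu : IsBoundedIIDSemicontinuous μ u umax)
        (_hwu : IndepFun (fun ω t => w t ω) (fun ω t => u t ω) μ)
        (_hLISS : IsLISS (sysMap θ φ) ρx ρ) (_hρ : max wmax umax ≤ ρ)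
        (_hcw : 0 < cw) (_htight : IsTightBound μ w wmax fun ℓ => min (cw * ℓ) 1)
        (F : Filtration ℕ ‹MeasurableSpace Ω›) (_hF : F = sysFiltration hw.measurable
          (measurable_sysState (θ := θ) hφ.measurable hw.measurable hu.measurable) hu.measurable)
        (b : ℝ) (_hb : b = (featureSup μ θ φ w u).toReal),
        featureSup μ θ φ w u ≠ ∞ ∧
        (∃ s p : ℝ, 0 < s ∧ 0 < p ∧ p < 1 ∧
          IsBMSB μ F (sysFeature θ φ w u) 1 (s ^ 2 • (1 : Matrix (Fin nφ) (Fin nφ) ℝ)) p) ∧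
        ∀ s p : ℝ, 0 < s → 0 < p → p < 1 →
          IsBMSB μ F (sysFeature θ φ w u) 1 (s ^ 2 • (1 : Matrix (Fin nφ) (Fin nφ) ℝ)) p →
          ∀ (ε : ℝ) (T m : ℕ), 0 < ε →
            K * ((Real.log (T / ε) + nφ * Real.log (8 * b / (s * p))) / p ^ 2) ≤ m → m ≤ T →
            μ {ω | ENNReal.ofReal (C * ((√nx * Real.log (1 / ε) +
                    (nx : ℝ) ^ (3 / 2 : ℝ) * nφ * Real.log (b * nx / (s * p))) /
                    (cw * s * p * T))) <
                  frobDiam (smeSet {v | ‖v‖ ≤ wmax} φ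
                    (fun t => sysState θ φ w u t ω) (fun t => u t ω) T)} ≤
              ENNReal.ofReal (2 * ε) := by
  refine ⟨8, 200, by norm_num, by norm_num, ?_⟩
  intro Ω _ μ _ nx nu nφ θ φ w u wmax umax ρx ρ cw hφ hw hu hwu hLISS hρ hcw htight F hF b hb
  have hwρ : ∀ᵐ ω ∂μ, ∀ t, ‖w t ω‖ ≤ ρ := ae_all_iff.2 fun t =>
    (hw.bounded t).mono fun ω h => h.trans ((le_max_left _ _).trans hρ)
  have huρ : ∀ᵐ ω ∂μ, ∀ t, ‖u t ω‖ ≤ ρ := ae_all_iff.2 fun t =>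
    (hu.bounded t).mono fun ω h => h.trans ((le_max_right _ _).trans hρ)
  obtain ⟨R, hR⟩ := hLISS.exists_norm_sysState_le (w := w) (u := u)
  have hx : ∀ᵐ ω ∂μ, ∀ t, ‖sysState θ φ w u t ω‖ ≤ R := by
    filter_upwards [hwρ, huρ] with ω h1 h2 using hR ω h1 h2
  have htop := featureSup_ne_top hφ.continuous hx huρ
  refine ⟨htop, ?_, ?_⟩
  · rw [hF]
    exact exists_isBMSB hφ hw hu hwu hx
  · intro s p hs hp _ hB ε T m hε hm hmT
    have hwF : ∀ t, Measurable[F (t + 1)] (w t) := by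
      intro t
      rw [hF]
      exact measurable_iff_comap_le.2 (le_sup_of_le_left (le_sup_of_le_left
        (le_iSup₂_of_le t (Nat.lt_succ_self t) le_rfl)))
    have hind : ∀ t, Indep (F t) (MeasurableSpace.comap (w t) inferInstance) μ := by
      intro t
      rw [hF]
      exact indep_of_indep_of_le_left (indep_of_indep_of_le_right
        (indep_noiseSigma hw.measurable hu.measurable hw.indep hu.indep hwu t) le_sup_left)
        (sysFiltration_le_noiseSigma hφ.measurable _ _ _ t)
    exact measure_lt_frobDiam_le hs hp hcw hB (hb ▸ ae_l2norm_sysFeature_le htop) hw.measurable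
      hwF hind htight hε (hm.trans (by exact_mod_cast hmT))
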